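/- All graphs are finite, simple and undirected. For a connected graph $G=(V,E)$ let $d(x,y)$ be the distance of $x,y\in V$, let $\mathrm{ecc}(x)=\max_{y\in V}d(x,y)$, and let $$s(G)=\min_{x\in V}\sum_{y\in V}d(x,y)$$ be the status of $G$. A tree $T$ of maximum degree $k$ is called $k$-balanced if it has a vertex $x$ such that every vertex $z$ with $d(z,x)\le \mathrm{ecc}(x)-2$ has degree $k$; $B_{n,k}$ denotes an arbitrary $k$-balanced tree of order $n$. For $n\ge 3$ and $k\ge 2$, the comet $S_{n,k}$ is the tree of order $n$ and maximum degree $k$ (unique up to isomorphism) that has a vertex $v$ of degree $k$ which lies on a path of length $n-k+1$ and has at least $k-1$ neighbours that are leaves. **Theorem** (Lin et al., 2011). Let $G$ be a connected graph of order $n$ and maximum degree $k$. Then $k$-balanced trees of order $n$ exist and, if $n\ge 3$, a comet $S_{n,k}$ exists. For every choice of $B_{n,k}$, and with $n\ge 3$ wherever $S_{n,k}$ occurs, $$s(B_{n,k})\le s(G)\le s(S_{n,k}).$$ Moreover: (i) $s(G)=s(B_{n,k})$ if and only if $G$ contains a $k$-balanced spanning tree (that is, a spanning tree of $G$ that is a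 $k$-balanced tree, in particular of maximum degree $k$). (ii) If $n\ge 3$ and $s(G)=s(S_{n,k})$, then $G$ contains a subgraph isomorphic to the comet $S_{n,k}$. -/

import Mathlib

namespace SimpleGraph

/-- The status of a vertex: the sum of its distances to all vertices. -/
noncomputable def vertexStatus {V : Type*} [Fintype V] (G : SimpleGraph V) (x : V) : ℕ :=
  ∑ y, G.dist x y

/-- The status of a graph: the minimum status of a vertex (over a nonempty vertex set, the infimum
of a family of natural numbers is a minimum). -/
noncomputable def status {V : Type*} [Fintype V] (G : SimpleGraph V) : ℕ :=
  ⨅ x, G.vertexStatus x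

open Classical in
/-- `T` is a `k`-balanced tree: a tree of maximum degree `k` with a vertex `x` such that every
vertex at distance at most `ecc(x) - 2` (a difference of integers, possibly negative) from `x`
has degree `k`. -/
def IsBalancedTree {V : Type*} [Fintype V] (T : SimpleGraph V) (k : ℕ) : Prop :=
  T.IsTree ∧ T.maxDegree = k ∧
    ∃ x, ∀ z, (T.dist z x : ℕ∞) + 2 ≤ T.eccent x → T.degree z = k

open Classical in
/-- `T` is a comet `S_{n,k}`, where `n ≥ 3` is the order of `T` and `k ≥ 2`: a tree of maximum
degree `k` with a vertex `v` of degree `k` that lies on a path of length `n - k + 1` and has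
`k - 1` neighbours that are leaves. (In the star, where `k = n - 1`, all `k` neighbours of `v` are
leaves; hence the inequality.) -/
def IsComet {V : Type*} [Fintype V] (T : SimpleGraph V) (k : ℕ) : Prop :=
  3 ≤ Fintype.card V ∧ 2 ≤ k ∧ T.IsTree ∧ T.maxDegree = k ∧
    ∃ v, T.degree v = k ∧
      (∃ (a b : V) (p : T.Walk a b),
        p.IsPath ∧ p.length + k = Fintype.card V + 1 ∧ v ∈ p.support) ∧
      k - 1 ≤ ((T.neighborFinset v).filter fun w => T.degree w = 1).card

end SimpleGraph

/-!
Both bounds compare `G` with rooted trees, which are encoded by parent functions (`IsParent`). In a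
connected graph, breadth-first search from any vertex gives a parent function whose level function
is the distance to that vertex (`Connected.exists_isParent`).

*Lower bound.* The status of a vertex `x` is the sum over `i` of the number of vertices at distance
more than `i` from `x`. The root of a breadth-first search tree has at most `k` children and the
other vertices have at most `k - 1`, so at most `ballBound k i` vertices are within distance `i`,
and `status G` is at least `balancedStatus n k`. In a balanced tree all these bounds are attained
(`IsBalancedTree.status_eq`). Conversely, if a vertex of minimum status attains them, then
every vertex above the last two levels of its breadth-first search tree has degree `k` in that tree,
which is therefore balanced (`exists_isBalancedTree_le`).

*Upper bound.* The distance between two vertices of a tree is the number of edges that separate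
them. Summing over a centroid, the status of the tree is the sum over all edges of the size of the
smaller side, and this is the sum over `j ≥ 1` of the number of edges with at least `j` vertices
on both sides (`deepEdges`). Take the breadth-first search tree from a vertex of degree `k`. For
`j ≥ 2` it has at most `n + 1 - j - max j k` such edges: `n + 1 - 2 j` because there must be `j`
vertices beyond either end (`deepEdges_le_sub_two_mul`), and `n + 1 - j - k` because every branch at
the root has a leaf (`deepEdges_le_sub_children`). The tail of the comet has exactly that many, so
that the comet is extremal for every `j` at once (`deepEdges_le_comet`).

*Equality in the upper bound.* For `k ≥ 3`, equality for `j = 2` says that every branch at the root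
is a path, and equality for `j = 3` says that only one of them has more than one edge
(`exists_level_ge`). So some vertex is at distance `n - k` from the root, and a shortest path to it
and the other neighbours of the root form a comet. For `k = 2` the comet is a path, and a longest
path of a connected graph of maximum degree two visits all vertices.
-/

namespace SimpleGraph

section

open scoped Classical

variable {V : Type*}

/-! ### Parent functions -/

/-- `p` is the parent function of a rooted tree on `V` with root `r`, and `l` is its level function.
The root is its own parent. -/
structure IsParent (p : V → V) (r : V) (l : V → ℕ) : Prop where
  root : p r = r
  level_root : l r = 0
  level : ∀ v, v ≠ r → l (p v) + 1 = l v

/-- `u` is an ancestor of `v` or `v` itself. -/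
def Anc (p : V → V) (u v : V) : Prop := ∃ m, p^[m] v = u

theorem Anc.refl (p : V → V) (u : V) : Anc p u u := ⟨0, rfl⟩

theorem Anc.trans {p : V → V} {u v w : V} : Anc p u v → Anc p v w → Anc p u w := by
  rintro ⟨m, rfl⟩ ⟨m', rfl⟩
  exact ⟨m + m', Function.iterate_add_apply _ _ _ _⟩

theorem anc_parent (p : V → V) (v : V) : Anc p (p v) v := ⟨1, rfl⟩

theorem anc_iff {p : V → V} {u v : V} : Anc p u v ↔ u = v ∨ Anc p u (p v) := by
  constructor
  · rintro ⟨m, rfl⟩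
    cases m with
    | zero => exact .inl rfl
    | succ m => exact .inr ⟨m, rfl⟩
  · rintro (rfl | h)
    · exact .refl _ _
    · exact h.trans (anc_parent _ _)

/-- The ancestors of a vertex form a chain. -/
theorem Anc.total {p : V → V} {u v x : V} : Anc p u x → Anc p v x → Anc p u v ∨ Anc p v u := by
  rintro ⟨m, rfl⟩ ⟨m', rfl⟩
  rcases le_total m m' with h | h
  · right
    exact ⟨m' - m, by rw [← Function.iterate_add_apply, Nat.sub_add_cancel h]⟩
  · left
    exact ⟨m - m', by rw [← Function.iterate_add_apply, Nat.sub_add_cancel h]⟩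

namespace IsParent

variable {p : V → V} {r : V} {l : V → ℕ} (h : IsParent p r l)
include h

theorem level_eq_zero {v : V} : l v = 0 ↔ v = r := by
  constructor
  · intro hv
    by_contra hne
    have := h.level v hne
    omega
  · rintro rfl
    exact h.level_root

theorem level_iterate (m : ℕ) (v : V) : l (p^[m] v) = l v - m := by
  induction m generalizing v with
  | zero => simp
  | succ m ih =>
    rw [Function.iterate_succ_apply, ih]
    by_cases hv : v = r
    · subst hv
      simp [h.root, h.level_root]
    · have := h.level v hv
      omega

theorem anc_root (v : V) : Anc p r v := ⟨l v, h.level_eq_zero.1 (by simp [h.level_iterate])⟩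

theorem level_le {u v : V} (huv : Anc p u v) : l u ≤ l v := by
  obtain ⟨m, rfl⟩ := huv
  simp [h.level_iterate]

theorem eq_of_level_eq {u v : V} (huv : Anc p u v) (hl : l v ≤ l u) : u = v := by
  obtain ⟨m, rfl⟩ := huv
  rw [h.level_iterate] at hl
  rcases Nat.eq_zero_or_pos m with rfl | hm
  · rfl
  · have : v = r := h.level_eq_zero.1 (by omega)
    subst this
    exact Function.iterate_fixed h.root m

theorem antisymm {u v : V} (huv : Anc p u v) (hvu : Anc p v u) : u = v :=
  h.eq_of_level_eq huv (h.level_le hvu)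

theorem not_anc_parent {v : V} (hv : v ≠ r) : ¬ Anc p v (p v) := fun hc => by
  have h1 := h.level_le hc
  have h2 := h.level v hv
  omega

theorem eq_of_anc_of_anc {u v x : V} (hu : Anc p u x) (hv : Anc p v x) (hl : l u = l v) :
    u = v := by
  rcases hu.total hv with h1 | h1
  · exact h.eq_of_level_eq h1 hl.ge
  · exact (h.eq_of_level_eq h1 hl.le).symm

/-- The ancestors of `v` are its iterated parents, one on each level. -/
theorem exists_anc_level (v : V) {i : ℕ} (hi : i ≤ l v) : ∃ u, Anc p u v ∧ l u = i :=
  ⟨p^[l v - i] v, ⟨_, rfl⟩, by rw [h.level_iterate]; omega⟩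

theorem ne_root {v : V} {i : ℕ} (hi : l v = i + 1) : v ≠ r := by
  rintro rfl
  simp [h.level_root] at hi

end IsParent

section desc

variable [Fintype V]

/-- The vertex set of the subtree hanging at `v`: the vertices with `v` among their ancestors. -/
noncomputable def desc (p : V → V) (v : V) : Finset V := Finset.univ.filter (Anc p v)

@[simp] theorem mem_desc {p : V → V} {u v : V} : u ∈ desc p v ↔ Anc p v u := by simp [desc]

theorem self_mem_desc (p : V → V) (v : V) : v ∈ desc p v := by simp [Anc.refl]

theorem desc_card_pos (p : V → V) (v : V) : 0 < (desc p v).card :=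
  Finset.card_pos.2 ⟨v, self_mem_desc p v⟩

theorem desc_subset {p : V → V} {u v : V} (huv : Anc p u v) : desc p v ⊆ desc p u := fun x hx => by
  simp only [mem_desc] at hx ⊢
  exact huv.trans hx

theorem desc_disjoint {p : V → V} {u v : V} (h1 : ¬ Anc p u v) (h2 : ¬ Anc p v u) :
    Disjoint (desc p u) (desc p v) := by
  rw [Finset.disjoint_left]
  intro x hx hy
  simp only [mem_desc] at hx hy
  rcases hx.total hy with h | h
  · exact h1 h
  · exact h2 h

namespace IsParent

variable {p : V → V} {r : V} {l : V → ℕ} (h : IsParent p r l)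
include h

theorem desc_ssubset {u v : V} (huv : Anc p u v) (hne : u ≠ v) : desc p v ⊂ desc p u := by
  refine (Finset.ssubset_iff_of_subset (desc_subset huv)).2 ⟨u, self_mem_desc p u, fun hc => ?_⟩
  exact hne (h.antisymm huv (mem_desc.1 hc))

theorem desc_card_lt {u v : V} (huv : Anc p u v) (hne : u ≠ v) :
    (desc p v).card < (desc p u).card :=
  Finset.card_lt_card (h.desc_ssubset huv hne)

theorem desc_root : desc p r = Finset.univ := by
  ext v
  simp [h.anc_root v]

end IsParent

/-! ### Distances in terms of separating vertices -/

/-- The number of subtrees that separate `x` from `y`; this is the distance from `x` to `y` in the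
tree with parent function `p`. -/
noncomputable def sepDist (p : V → V) (x y : V) : ℕ :=
  (Finset.univ.filter fun v => ¬ (Anc p v x ↔ Anc p v y)).card

theorem sepDist_comm (p : V → V) (x y : V) : sepDist p x y = sepDist p y x := by
  unfold sepDist
  congr 1
  ext v
  simp [iff_comm]

theorem sepDist_triangle (p : V → V) (x y z : V) :
    sepDist p x z ≤ sepDist p x y + sepDist p y z := by
  unfold sepDist
  refine le_trans (Finset.card_le_card ?_) (Finset.card_union_le _ _)
  intro v
  simp only [Finset.mem_filter, Finset.mem_univ, true_and, Finset.mem_union]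
  tauto

theorem sepDist_self (p : V → V) (x : V) : sepDist p x x = 0 := by simp [sepDist]

theorem sepDist_parent (p : V → V) (v : V) :
    sepDist p v (p v) ≤ 1 := by
  unfold sepDist
  refine (Finset.card_le_card (t := {v}) ?_).trans (by simp)
  intro u
  simp only [Finset.mem_filter, Finset.mem_univ, true_and, Finset.mem_singleton]
  intro hu
  by_contra hne
  exact hu (by rw [anc_iff]; simp [hne])

/-- A step from `x` to its parent leaves exactly one subtree, the one at `x`. -/
theorem IsParent.sepDist_parent_lt {p : V → V} {r : V} {l : V → ℕ} (h : IsParent p r l) {x y : V}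
    (hx : x ≠ r) (hxy : ¬ Anc p x y) : sepDist p (p x) y + 1 ≤ sepDist p x y := by
  unfold sepDist
  refine Nat.succ_le_of_lt (Finset.card_lt_card ((Finset.ssubset_iff_of_subset ?_).2 ⟨x, ?_, ?_⟩))
  · intro u
    simp only [Finset.mem_filter, Finset.mem_univ, true_and]
    intro hu hc
    apply hu
    rw [← hc, anc_iff (v := x)]
    constructor
    · exact .inr
    · rintro (rfl | h1)
      · exact absurd (hc.1 (.refl _ _)) hxy
      · exact h1
  · simp [hxy, Anc.refl]
  · simp [hxy, h.not_anc_parent hx]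

theorem IsParent.sepDist_root {p : V → V} {r : V} {l : V → ℕ} (h : IsParent p r l) (v : V) :
    l v ≤ sepDist p r v := by
  have : Nonempty V := ⟨r⟩
  choose! f hf using fun i (hi : i ≤ l v) => h.exists_anc_level v hi
  have : (Finset.Icc 1 (l v)).card ≤ sepDist p r v := by
    refine Finset.card_le_card_of_injOn f ?_ ?_
    · intro i hi
      simp only [Finset.coe_Icc, Set.mem_Icc] at hi
      have := hf i hi.2
      simp only [Finset.coe_filter, Finset.mem_univ, true_and, Set.mem_ofPred_eq]
      intro hc
      have := h.level_le (hc.2 this.1)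
      rw [h.level_root] at this
      omega
    · intro i hi j hj hij
      simp only [Finset.coe_Icc, Set.mem_Icc] at hi hj
      rw [← (hf i hi.2).2, ← (hf j hj.2).2, hij]
  simpa using this

/-- If every vertex is adjacent to its parent, then walking along parents realises `sepDist`. -/
theorem IsParent.dist_le_sepDist {p : V → V} {r : V} {l : V → ℕ} (h : IsParent p r l)
    {G : SimpleGraph V} (hG : G.Connected) (hadj : ∀ v, v ≠ r → G.Adj v (p v)) (x y : V) :
    G.dist x y ≤ sepDist p x y := by
  induction hd : sepDist p x y using Nat.strong_induction_on generalizing x y with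
  | _ d ih =>
    -- If the subtree at `x` does not contain `y`, then the way to `y` goes through the parent.
    have key : ∀ x y : V, sepDist p x y = d → ¬ Anc p x y → G.dist x y ≤ d := by
      intro x y hd hxy
      have hx : x ≠ r := by
        rintro rfl
        exact hxy (h.anc_root y)
      have h1 := h.sepDist_parent_lt hx hxy
      have h2 := ih (sepDist p (p x) y) (by omega) (p x) y rfl
      have h3 := hG.dist_triangle (u := x) (v := p x) (w := y)
      rw [(dist_eq_one_iff_adj).2 (hadj x hx)] at h3
      omega
    by_cases h1 : Anc p x y
    · by_cases h2 : Anc p y x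
      · rw [h.antisymm h1 h2]
        simp
      · rw [dist_comm]
        exact key y x (by rw [sepDist_comm, hd]) h2
    · exact key x y hd h1

/-- Each subtree contributes the number of vertices that it separates from `x`. -/
theorem sum_sepDist (p : V → V) (x : V) :
    ∑ y, sepDist p x y =
      ∑ v, if Anc p v x then Fintype.card V - (desc p v).card else (desc p v).card := by
  unfold sepDist
  simp_rw [Finset.card_filter]
  rw [Finset.sum_comm]
  refine Finset.sum_congr rfl fun v _ => ?_
  rw [← Finset.card_filter]
  split_ifs with hv
  · simp only [hv, true_iff, desc]
    rw [← Finset.card_compl, Finset.compl_filter]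
  · simp [hv, desc]

end desc

/-! ### The graph of a parent function -/

/-- The tree with parent function `p`. -/
def parentGraph (p : V → V) : SimpleGraph V := fromRel fun u v => p u = v

theorem parentGraph_adj {p : V → V} {u v : V} :
    (parentGraph p).Adj u v ↔ u ≠ v ∧ (p u = v ∨ p v = u) := by simp [parentGraph]

namespace IsParent

variable {p : V → V} {r : V} {l : V → ℕ} (h : IsParent p r l)
include h

theorem parent_ne {v : V} (hv : v ≠ r) : v ≠ p v := fun hc => by
  have := h.level v hv
  rw [← hc] at this
  omega

theorem parentGraph_adj_parent {v : V} (hv : v ≠ r) : (parentGraph p).Adj v (p v) :=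
  parentGraph_adj.2 ⟨h.parent_ne hv, .inl rfl⟩

theorem parentGraph_le {G : SimpleGraph V} (hadj : ∀ v, v ≠ r → G.Adj v (p v)) :
    parentGraph p ≤ G := by
  have key : ∀ u v, u ≠ v → p u = v → G.Adj u v := by
    rintro u v hne rfl
    exact hadj u fun hc => hne (by rw [hc, h.root])
  intro u v huv
  rcases parentGraph_adj.1 huv with ⟨hne, h1 | h1⟩
  · exact key u v hne h1
  · exact (key v u hne.symm h1).symm

theorem parentGraph_connected : (parentGraph p).Connected := by
  have key : ∀ n v, l v = n → (parentGraph p).Reachable v r := by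
    intro n
    induction n with
    | zero =>
      intro v hv
      rw [h.level_eq_zero.1 hv]
    | succ n ih =>
      intro v hv
      have hv' := h.ne_root hv
      exact (h.parentGraph_adj_parent hv').reachable.trans (ih _ (by have := h.level v hv'; omega))
  have : Nonempty V := ⟨r⟩
  exact ⟨fun u v => (key _ u rfl).trans (key _ v rfl).symm⟩

/-- Every edge joins a vertex other than the root to its parent, so there are few enough edges. -/
theorem parentGraph_isTree [Fintype V] : (parentGraph p).IsTree := by
  rw [isTree_iff_connected_and_card]
  refine ⟨h.parentGraph_connected, le_antisymm ?_
    h.parentGraph_connected.card_vert_le_card_edgeSet_add_one⟩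
  have h1 : (parentGraph p).edgeFinset ⊆ (Finset.univ.erase r).image fun v => s(v, p v) := by
    intro e
    induction e using Sym2.ind with
    | _ u v =>
      rw [mem_edgeFinset, mem_edgeSet, parentGraph_adj, Finset.mem_image]
      rintro ⟨hne, rfl | rfl⟩
      · exact ⟨u, by simpa using fun hc => hne (by rw [hc, h.root]), rfl⟩
      · exact ⟨v, by simpa using fun hc => hne (by rw [hc, h.root]), Sym2.eq_swap⟩
  have h2 := (Finset.card_le_card h1).trans Finset.card_image_le
  rw [Finset.card_erase_of_mem (Finset.mem_univ r), Finset.card_univ] at h2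
  rw [Nat.card_eq_fintype_card, Nat.card_eq_fintype_card, ← edgeFinset_card]
  have : 0 < Fintype.card V := Fintype.card_pos_iff.2 ⟨r⟩
  omega

theorem sepDist_le_dist [Fintype V] (x y : V) : sepDist p x y ≤ (parentGraph p).dist x y := by
  obtain ⟨w, hw⟩ := h.parentGraph_connected.exists_walk_length_eq_dist x y
  rw [← hw]
  clear hw
  induction w with
  | nil => simp [sepDist_self]
  | @cons u v w huv q ih =>
    have h1 : sepDist p u v ≤ 1 := by
      rcases (parentGraph_adj.1 huv).2 with rfl | rfl
      · exact sepDist_parent p u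
      · rw [sepDist_comm]
        exact sepDist_parent p v
    have := sepDist_triangle p u v w
    rw [Walk.length_cons]
    omega

theorem dist_le_level {G : SimpleGraph V} (hG : G.Connected) (hadj : ∀ v, v ≠ r → G.Adj v (p v))
    (v : V) : G.dist r v ≤ l v := by
  induction hn : l v generalizing v with
  | zero => simp [h.level_eq_zero.1 hn]
  | succ n ih =>
    have hv := h.ne_root hn
    have h1 := ih (p v) (by have := h.level v hv; omega)
    have h2 := hG.dist_triangle (u := r) (v := p v) (w := v)
    rw [(dist_eq_one_iff_adj).2 (hadj v hv).symm] at h2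
    omega

theorem parentGraph_dist [Fintype V] (v : V) : (parentGraph p).dist r v = l v :=
  le_antisymm (h.dist_le_level h.parentGraph_connected (fun _ => h.parentGraph_adj_parent) v)
    ((h.sepDist_root v).trans (h.sepDist_le_dist r v))

end IsParent

/-- The children of `v` in the tree with parent function `p` and root `r`. -/
noncomputable def children [Fintype V] (p : V → V) (r v : V) : Finset V :=
  Finset.univ.filter fun u => u ≠ r ∧ p u = v

@[simp] theorem mem_children [Fintype V] {p : V → V} {r u v : V} :
    u ∈ children p r v ↔ u ≠ r ∧ p u = v := by simp [children]

namespace IsParent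

variable [Fintype V] {p : V → V} {r : V} {l : V → ℕ} (h : IsParent p r l)
include h

theorem parent_notMem_children {v : V} (hv : v ≠ r) : p v ∉ children p r v := by
  rw [mem_children]
  rintro ⟨h1, h2⟩
  have h3 := h.level _ h1
  have h4 := h.level _ hv
  rw [h2] at h3
  omega

theorem card_children_add_le_degree {G : SimpleGraph V} (hadj : ∀ v, v ≠ r → G.Adj v (p v))
    (v : V) : (children p r v).card + (if v = r then 0 else 1) ≤ G.degree v := by
  have hsub : children p r v ⊆ G.neighborFinset v := by
    intro u hu
    obtain ⟨h1, rfl⟩ := mem_children.1 hu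
    exact (G.mem_neighborFinset _ _).2 (hadj u h1).symm
  rw [← card_neighborFinset_eq_degree]
  split_ifs with hv
  · exact Finset.card_le_card hsub
  · rw [← Finset.card_insert_of_notMem (h.parent_notMem_children hv)]
    exact Finset.card_le_card (Finset.insert_subset
      ((G.mem_neighborFinset _ _).2 (hadj v hv)) hsub)

theorem parentGraph_degree (v : V) :
    (parentGraph p).degree v = (children p r v).card + (if v = r then 0 else 1) := by
  refine le_antisymm ?_ (h.card_children_add_le_degree (fun _ => h.parentGraph_adj_parent) v)
  rw [← card_neighborFinset_eq_degree]
  have key : ∀ u, (parentGraph p).Adj v u → u ∈ children p r v ∨ v ≠ r ∧ u = p v := by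
    intro u hu
    rw [parentGraph_adj] at hu
    obtain ⟨hne, rfl | rfl⟩ := hu
    · exact .inr ⟨fun hc => hne (by rw [hc, h.root]), rfl⟩
    · exact .inl (mem_children.2 ⟨fun hc => hne (by rw [hc, h.root]), rfl⟩)
  split_ifs with hv
  · refine Finset.card_le_card fun u hu => ?_
    exact (key u ((mem_neighborFinset _ _ _).1 hu)).resolve_right fun hc => hc.1 hv
  · rw [← Finset.card_insert_of_notMem (h.parent_notMem_children hv)]
    refine Finset.card_le_card fun u hu => ?_
    rcases key u ((mem_neighborFinset _ _ _).1 hu) with h1 | h1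
    · exact Finset.mem_insert_of_mem h1
    · simp [h1.2]

end IsParent

/-- A connected graph has a breadth-first search tree from every vertex. -/
theorem Connected.exists_isParent {G : SimpleGraph V} (hG : G.Connected) (r : V) :
    ∃ p, IsParent p r (G.dist r) ∧ ∀ v, v ≠ r → G.Adj v (p v) := by
  have key : ∀ v, ∃ u, (v = r → u = r) ∧ (v ≠ r → G.Adj v u ∧ G.dist r u + 1 = G.dist r v) := by
    intro v
    by_cases hv : v = r
    · exact ⟨r, fun _ => rfl, fun hc => absurd hv hc⟩
    obtain ⟨w, hw⟩ := hG.exists_walk_length_eq_dist v r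
    cases w with
    | nil => exact absurd rfl hv
    | @cons _ u _ hvu q =>
      refine ⟨u, fun hc => absurd hc hv, fun _ => ⟨hvu, ?_⟩⟩
      have h1 := dist_le q
      have h2 := hG.dist_triangle (u := v) (v := u) (w := r)
      rw [(dist_eq_one_iff_adj).2 hvu] at h2
      rw [Walk.length_cons] at hw
      rw [dist_comm (u := r) (v := u), dist_comm (u := r) (v := v)]
      omega
  choose p hp using key
  exact ⟨p, ⟨(hp r).1 rfl, dist_self, fun v hv => ((hp v).2 hv).2⟩, fun v hv => ((hp v).2 hv).1⟩

end

section

open scoped Classical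

variable {V : Type*} [Fintype V]

/-! ### Level sizes and the lower bound -/

/-- The greatest possible number of vertices at distance at most `i` from a given vertex in a graph
of maximum degree `k`. -/
def ballBound (k i : ℕ) : ℕ := 1 + k * ∑ j ∈ Finset.range i, (k - 1) ^ j

theorem ballBound_succ (k i : ℕ) : ballBound k (i + 1) = ballBound k i + k * (k - 1) ^ i := by
  simp [ballBound, Finset.sum_range_succ, mul_add, add_assoc]

/-- The status of a `k`-balanced tree of order `n`: the `i`-th summand is the number of vertices at
distance more than `i` from the centre. The subtraction is truncated, as it has to be once the
bound for the ball exceeds the order. -/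
def balancedStatus (n k : ℕ) : ℕ := ∑ i ∈ Finset.range n, (n - ballBound k i)

theorem status_le_vertexStatus (G : SimpleGraph V) (x : V) : G.status ≤ G.vertexStatus x :=
  ciInf_le (OrderBot.bddBelow _) x

theorem exists_vertexStatus_eq_status [Nonempty V] (G : SimpleGraph V) :
    ∃ x, G.vertexStatus x = G.status :=
  exists_eq_ciInf_of_finite

theorem status_anti {G H : SimpleGraph V} (hle : H ≤ G) (hH : H.Connected) :
    G.status ≤ H.status := by
  have := hH.nonempty
  obtain ⟨x, hx⟩ := H.exists_vertexStatus_eq_status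
  rw [← hx]
  exact (G.status_le_vertexStatus x).trans
    (Finset.sum_le_sum fun y _ => (hH x y).dist_anti hle)

theorem coe_le_eccent_iff {G : SimpleGraph V} (hG : G.Connected) {x : V} {m : ℕ} :
    (m : ℕ∞) ≤ G.eccent x ↔ ∃ y, m ≤ G.dist x y := by
  have := hG.nonempty
  constructor
  · intro hm
    obtain ⟨y, hy⟩ := G.exists_edist_eq_eccent_of_finite x
    refine ⟨y, ?_⟩
    rw [← hy, ← (hG x y).coe_dist_eq_edist] at hm
    exact_mod_cast hm
  · rintro ⟨y, hy⟩
    refine le_trans ?_ (edist_le_eccent (v := y))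
    rw [← (hG x y).coe_dist_eq_edist]
    exact_mod_cast hy

/-- Adding up over the levels: a vertex on level `l v` is counted once for each `i < l v`. -/
theorem sum_eq_sum_card_lt (l : V → ℕ) (hl : ∀ v, l v < Fintype.card V) :
    ∑ v, l v = ∑ i ∈ Finset.range (Fintype.card V),
      (Fintype.card V - (Finset.univ.filter fun v => l v ≤ i).card) := by
  have h1 : ∀ v, l v = ∑ i ∈ Finset.range (Fintype.card V), if i < l v then 1 else 0 := by
    intro v
    rw [← Finset.card_filter]
    have : ((Finset.range (Fintype.card V)).filter fun i => i < l v) = Finset.range (l v) := by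
      ext i
      have := hl v
      simp only [Finset.mem_filter, Finset.mem_range]
      omega
    rw [this, Finset.card_range]
  rw [Finset.sum_congr rfl fun v _ => h1 v, Finset.sum_comm]
  refine Finset.sum_congr rfl fun i _ => ?_
  rw [← Finset.card_filter, ← Finset.card_compl, Finset.compl_filter]
  simp

namespace IsParent

variable {p : V → V} {r : V} {l : V → ℕ} (h : IsParent p r l)
include h

theorem level_lt_card (v : V) : l v < Fintype.card V := by
  have : Nonempty V := ⟨r⟩
  choose! f hf using fun i (hi : i ≤ l v) => h.exists_anc_level v hi
  have : (Finset.range (l v + 1)).card ≤ (Finset.univ : Finset V).card := by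
    refine Finset.card_le_card_of_injOn f (by simp) ?_
    intro i hi j hj hij
    simp only [Finset.coe_range, Set.mem_Iio] at hi hj
    rw [← (hf i (by omega)).2, ← (hf j (by omega)).2, hij]
  simpa using this

theorem card_level_succ (i : ℕ) :
    (Finset.univ.filter fun v => l v = i + 1).card =
      ∑ v ∈ Finset.univ.filter (fun v => l v = i), (children p r v).card := by
  rw [Finset.card_eq_sum_card_fiberwise (f := p) (t := Finset.univ.filter fun v => l v = i)]
  · refine Finset.sum_congr rfl fun v hv => ?_
    congr 1
    ext u
    simp only [Finset.mem_filter, Finset.mem_univ, true_and, mem_children] at hv ⊢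
    refine and_congr_left ?_
    rintro rfl
    refine ⟨fun hu => h.ne_root hu, fun hu => ?_⟩
    have := h.level u hu
    omega
  · intro u hu
    simp only [Finset.coe_filter, Finset.mem_univ, true_and, Set.mem_ofPred_eq] at hu ⊢
    have := h.level u (h.ne_root hu)
    omega

theorem filter_level_zero : (Finset.univ.filter fun v => l v = 0) = {r} := by
  ext v
  simp [h.level_eq_zero]

omit h in
theorem card_le_succ (i : ℕ) :
    (Finset.univ.filter fun v => l v ≤ i + 1).card =
      (Finset.univ.filter fun v => l v ≤ i).card +
        (Finset.univ.filter fun v => l v = i + 1).card := by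
  rw [← Finset.card_union_of_disjoint]
  · congr 1
    ext v
    simp only [Finset.mem_filter, Finset.mem_univ, true_and, Finset.mem_union]
    omega
  · rw [Finset.disjoint_filter]
    intros
    omega

theorem card_level_le {k : ℕ} (hk : ∀ v, (children p r v).card + (if v = r then 0 else 1) ≤ k)
    (i : ℕ) : (Finset.univ.filter fun v => l v = i + 1).card ≤ k * (k - 1) ^ i := by
  induction i with
  | zero =>
    rw [h.card_level_succ, h.filter_level_zero]
    simpa using hk r
  | succ i ih =>
    rw [h.card_level_succ, pow_succ, ← mul_assoc]
    refine (Finset.sum_le_card_nsmul _ _ (k - 1) fun v hv => ?_).trans ?_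
    · have hv' : v ≠ r := h.ne_root (by simpa using hv)
      have := hk v
      rw [if_neg hv'] at this
      omega
    · rw [smul_eq_mul]
      exact Nat.mul_le_mul_right _ ih

theorem card_level_eq {k : ℕ} {i : ℕ}
    (hk : ∀ v, l v ≤ i → (children p r v).card + (if v = r then 0 else 1) = k) :
    (Finset.univ.filter fun v => l v = i + 1).card = k * (k - 1) ^ i := by
  induction i with
  | zero =>
    rw [h.card_level_succ, h.filter_level_zero]
    simpa using hk r h.level_root.le
  | succ i ih =>
    rw [h.card_level_succ, pow_succ, ← mul_assoc, ← ih fun v hv => hk v (by omega),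
      ← smul_eq_mul]
    refine Finset.sum_eq_card_nsmul fun v hv => ?_
    simp only [Finset.mem_filter, Finset.mem_univ, true_and] at hv
    have := hk v hv.le
    rw [if_neg (h.ne_root hv)] at this
    omega

theorem card_le_ballBound {k : ℕ}
    (hk : ∀ v, (children p r v).card + (if v = r then 0 else 1) ≤ k) (i : ℕ) :
    (Finset.univ.filter fun v => l v ≤ i).card ≤ ballBound k i := by
  induction i with
  | zero =>
    simp [ballBound, h.filter_level_zero]
  | succ i ih =>
    rw [card_le_succ, ballBound_succ]
    exact Nat.add_le_add ih (h.card_level_le hk i)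

theorem card_eq_ballBound {k i : ℕ}
    (hk : ∀ v, l v + 1 ≤ i → (children p r v).card + (if v = r then 0 else 1) = k) :
    (Finset.univ.filter fun v => l v ≤ i).card = ballBound k i := by
  induction i with
  | zero =>
    simp [ballBound, h.filter_level_zero]
  | succ i ih =>
    rw [card_le_succ, ballBound_succ, ih fun v hv => hk v (by omega),
      h.card_level_eq fun v hv => hk v (by omega)]

theorem balancedStatus_le {k : ℕ}
    (hk : ∀ v, (children p r v).card + (if v = r then 0 else 1) ≤ k) :
    balancedStatus (Fintype.card V) k ≤ ∑ v, l v := by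
  rw [sum_eq_sum_card_lt l h.level_lt_card]
  exact Finset.sum_le_sum fun i _ => Nat.sub_le_sub_left (h.card_le_ballBound hk i) _

/-- If all vertices above the last two levels have as many children as possible, then the levels are
as large as possible until the vertices are used up. -/
theorem sum_level_le {k : ℕ}
    (hk : ∀ z y, l z + 2 ≤ l y → (children p r z).card + (if z = r then 0 else 1) = k) :
    ∑ v, l v ≤ balancedStatus (Fintype.card V) k := by
  rw [sum_eq_sum_card_lt l h.level_lt_card]
  refine Finset.sum_le_sum fun i _ => ?_
  by_cases hi : ∃ y, i < l y
  · obtain ⟨y, hy⟩ := hi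
    rw [h.card_eq_ballBound fun v hv => hk v y (by omega)]
  · push Not at hi
    simp [hi]

/-- In the case of equality, all levels but the last are as large as the degrees allow, so that
every vertex above the last two levels has all the children that it can have. -/
theorem children_of_sum_level_eq {k : ℕ}
    (hk : ∀ v, (children p r v).card + (if v = r then 0 else 1) ≤ k)
    (hs : ∑ v, l v = balancedStatus (Fintype.card V) k) {z y : V} (hzy : l z + 2 ≤ l y) :
    (children p r z).card + (if z = r then 0 else 1) = k := by
  rw [sum_eq_sum_card_lt l h.level_lt_card, eq_comm, balancedStatus,
    Finset.sum_eq_sum_iff_of_le fun i _ => Nat.sub_le_sub_left (h.card_le_ballBound hk i) _] at hs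
  have hball : ∀ i, i < l y → (Finset.univ.filter fun v => l v ≤ i).card = ballBound k i := by
    intro i hi
    have h1 := hs i (Finset.mem_range.2 (hi.trans (h.level_lt_card y)))
    have h2 : (Finset.univ.filter fun v => l v ≤ i).card < Fintype.card V := by
      rw [← Finset.card_univ]
      refine Finset.card_lt_card ((Finset.ssubset_univ_iff).2 fun hc => ?_)
      have := hc ▸ Finset.mem_univ y
      simp only [Finset.mem_filter, Finset.mem_univ, true_and] at this
      omega
    have h3 := h.card_le_ballBound hk i
    omega
  have hlev : (Finset.univ.filter fun v => l v = l z + 1).card = k * (k - 1) ^ (l z) := by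
    have h1 := card_le_succ (l := l) (l z)
    rw [hball _ (by omega), hball _ (by omega), ballBound_succ] at h1
    omega
  refine le_antisymm (hk z) (not_lt.1 fun hlt => hlev.not_lt ?_)
  rw [h.card_level_succ]
  rcases hz : l z with _ | m
  · obtain rfl := h.level_eq_zero.1 hz
    rw [h.filter_level_zero]
    simpa using hlt
  · have hzr := h.ne_root hz
    have hch : ∀ v ∈ Finset.univ.filter (fun v => l v = m + 1), (children p r v).card ≤ k - 1 := by
      intro v hv
      have h1 : v ≠ r := h.ne_root (by simpa using hv)
      have h2 := hk v
      rw [if_neg h1] at h2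
      omega
    have h1 : ∑ v ∈ Finset.univ.filter (fun v => l v = m + 1), (children p r v).card <
        ∑ v ∈ Finset.univ.filter (fun v => l v = m + 1), (k - 1) := by
      refine Finset.sum_lt_sum hch ⟨z, by simpa using hz, ?_⟩
      rw [if_neg hzr] at hlt
      omega
    refine h1.trans_le ?_
    rw [Finset.sum_const, smul_eq_mul, pow_succ, ← mul_assoc]
    exact Nat.mul_le_mul_right _ (h.card_level_le hk m)

end IsParent

omit [Fintype V] in
theorem IsTree.eq_of_connected_le {T H : SimpleGraph V} (hT : T.IsTree) (hle : H ≤ T)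
    (hH : H.Connected) : H = T :=
  le_antisymm hle ((isTree_iff_minimal_connected.1 hT).2 hH hle)

theorem card_children_add_le {G : SimpleGraph V} {k : ℕ} (hk : G.maxDegree ≤ k) {p : V → V} {r : V}
    {l : V → ℕ} (h : IsParent p r l) (hadj : ∀ v, v ≠ r → G.Adj v (p v)) (v : V) :
    (children p r v).card + (if v = r then 0 else 1) ≤ k :=
  (h.card_children_add_le_degree hadj v).trans ((G.degree_le_maxDegree v).trans hk)

theorem balancedStatus_le_vertexStatus {G : SimpleGraph V} (hG : G.Connected) {k : ℕ}
    (hk : G.maxDegree ≤ k) (x : V) : balancedStatus (Fintype.card V) k ≤ G.vertexStatus x := by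
  obtain ⟨p, h, hadj⟩ := hG.exists_isParent x
  exact h.balancedStatus_le (card_children_add_le hk h hadj)

theorem balancedStatus_le_status {G : SimpleGraph V} (hG : G.Connected) {k : ℕ}
    (hk : G.maxDegree ≤ k) : balancedStatus (Fintype.card V) k ≤ G.status := by
  have := hG.nonempty
  obtain ⟨x, hx⟩ := G.exists_vertexStatus_eq_status
  exact hx ▸ balancedStatus_le_vertexStatus hG hk x

/-- A balanced tree is the breadth-first search tree from its centre, so that its degrees determine
the level sizes. -/
theorem IsBalancedTree.status_eq {T : SimpleGraph V} {k : ℕ} (hT : T.IsBalancedTree k) :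
    T.status = balancedStatus (Fintype.card V) k := by
  obtain ⟨hT, hk, x, hx⟩ := hT
  refine le_antisymm ?_ (balancedStatus_le_status hT.connected hk.le)
  obtain ⟨p, h, hadj⟩ := hT.connected.exists_isParent x
  have hp : parentGraph p = T := hT.eq_of_connected_le (h.parentGraph_le hadj)
    h.parentGraph_connected
  refine (T.status_le_vertexStatus x).trans (h.sum_level_le fun z y hzy => ?_)
  rw [← h.parentGraph_degree]
  have hxz : T.degree z = k := by
    refine hx z ?_
    have := (coe_le_eccent_iff hT.connected).2 ⟨y, hzy⟩
    rw [dist_comm]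
    exact_mod_cast this
  convert hxz

/-- The breadth-first search tree from a vertex of minimum status is balanced if the bound is
attained. -/
theorem exists_isBalancedTree_le {G : SimpleGraph V} (hG : G.Connected) {k : ℕ}
    (hk : G.maxDegree = k) (hs : G.status = balancedStatus (Fintype.card V) k) :
    ∃ T, T ≤ G ∧ T.IsBalancedTree k := by
  have := hG.nonempty
  obtain ⟨x, hx⟩ := G.exists_vertexStatus_eq_status
  obtain ⟨p, h, hadj⟩ := hG.exists_isParent x
  have hch := card_children_add_le hk.le h hadj
  have hfull : ∀ z y, G.dist x z + 2 ≤ G.dist x y →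
      (children p x z).card + (if z = x then 0 else 1) = k :=
    fun z y hzy => h.children_of_sum_level_eq hch (hx.trans hs) hzy
  refine ⟨parentGraph p, h.parentGraph_le hadj, h.parentGraph_isTree, le_antisymm ?_ ?_, x, ?_⟩
  · exact maxDegree_le_of_forall_degree_le _ _ fun v => (h.parentGraph_degree v).trans_le (hch v)
  · refine le_trans ?_ (degree_le_maxDegree _ x)
    rw [h.parentGraph_degree]
    by_cases hy : ∃ y, 2 ≤ G.dist x y
    · obtain ⟨y, hy⟩ := hy
      exact (hfull x y (by simpa using hy)).ge
    · -- If all vertices are within distance 1, then they are children of the root.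
      push Not at hy
      have h1 : children p x x = Finset.univ.erase x := by
        ext v
        simp only [mem_children, Finset.mem_erase, Finset.mem_univ, and_true, and_iff_left_iff_imp]
        intro hv
        have h1 := h.level v hv
        have h2 := hy v
        exact h.level_eq_zero.1 (by omega)
      rw [h1, Finset.card_erase_of_mem (Finset.mem_univ x), Finset.card_univ, if_pos rfl, ← hk]
      have := G.maxDegree_lt_card_verts
      omega
  · intro z hz
    have hz' : ((((parentGraph p).dist z x + 2 : ℕ)) : ℕ∞) ≤ (parentGraph p).eccent x := by
      exact_mod_cast hz
    obtain ⟨y, hy⟩ := (coe_le_eccent_iff h.parentGraph_connected).1 hz'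
    rw [dist_comm, h.parentGraph_dist, h.parentGraph_dist] at hy
    rw [h.parentGraph_degree]
    exact hfull z y hy

/-! ### Parent functions on an initial segment of the natural numbers -/

/-- The level function for the parent function `q` on the natural numbers, with root `0`. The value
at `i + 1` is meaningful only if the parent `q (i + 1)` is smaller than `i + 1`. -/
def depth (q : ℕ → ℕ) : ℕ → ℕ
  | 0 => 0
  | i + 1 => if q (i + 1) < i + 1 then depth q (q (i + 1)) + 1 else 0

theorem depth_of_lt {q : ℕ → ℕ} {i : ℕ} (hi : q i < i) : depth q i = depth q (q i) + 1 := by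
  cases i with
  | zero => omega
  | succ i => rw [depth, if_pos hi]

theorem depth_mono {q : ℕ → ℕ} (hq : ∀ i, 0 < i → q i < i) (hmono : Monotone q) :
    Monotone (depth q) := by
  intro i j hij
  induction j using Nat.strong_induction_on generalizing i with
  | _ j ih =>
    rcases Nat.eq_zero_or_pos i with rfl | hi
    · simp [depth]
    · rw [depth_of_lt (hq i hi), depth_of_lt (hq j (hi.trans_le hij))]
      exact Nat.succ_le_succ (ih _ (hq j (hi.trans_le hij)) (hmono hij))

/-- The restriction to `Fin n` of a parent function on the natural numbers. -/
def finParent (n : ℕ) {q : ℕ → ℕ} (hq : ∀ i, q i ≤ i) (i : Fin n) : Fin n :=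
  ⟨q i, (hq i).trans_lt i.2⟩

theorem isParent_finParent (n : ℕ) [NeZero n] {q : ℕ → ℕ} (hq : ∀ i, q i ≤ i)
    (hlt : ∀ i, 0 < i → q i < i) : IsParent (finParent n hq) 0 fun i => depth q i where
  root := Fin.ext (by simpa [finParent] using hq 0)
  level_root := by simp [depth]
  level := fun v hv => by
    have : 0 < (v : ℕ) := Nat.pos_of_ne_zero fun hc => hv (Fin.ext (by simpa using hc))
    exact (depth_of_lt (hlt _ this)).symm

theorem map_children_finParent (n : ℕ) [NeZero n] {q : ℕ → ℕ} (hq : ∀ i, q i ≤ i) (i : Fin n) :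
    (children (finParent n hq) 0 i).map Fin.valEmbedding =
      (Finset.range n).filter fun j => j ≠ 0 ∧ q j = i := by
  ext j
  simp only [Finset.mem_map, mem_children, Fin.valEmbedding_apply, Finset.mem_filter,
    Finset.mem_range]
  constructor
  · rintro ⟨u, ⟨h1, h2⟩, rfl⟩
    exact ⟨u.2, fun hc => h1 (Fin.ext (by simpa using hc)), congrArg Fin.val h2⟩
  · rintro ⟨h1, h2, h3⟩
    exact ⟨⟨j, h1⟩, ⟨fun hc => h2 (by simpa using congrArg Fin.val hc), Fin.ext h3⟩, rfl⟩

theorem card_children_finParent (n : ℕ) [NeZero n] {q : ℕ → ℕ} (hq : ∀ i, q i ≤ i) {i : Fin n}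
    {m : ℕ} (hi : (i : ℕ) = m) :
    (children (finParent n hq) 0 i).card =
      ((Finset.range n).filter fun j => j ≠ 0 ∧ q j = m).card := by
  rw [← hi, ← map_children_finParent n hq, Finset.card_map]

/-- Maximum degree `0` or `1` leaves only the graphs with one vertex or one edge. -/
theorem Connected.card_le_of_maxDegree_le_one {G : SimpleGraph V} (hG : G.Connected)
    (hk : G.maxDegree ≤ 1) : Fintype.card V ≤ G.maxDegree + 1 := by
  obtain ⟨r⟩ := hG.nonempty
  obtain ⟨p, h, hadj⟩ := hG.exists_isParent r
  have h1 := h.card_le_ballBound (card_children_add_le le_rfl h hadj) (Fintype.card V)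
  rw [Finset.filter_true_of_mem fun v _ => (h.level_lt_card v).le, Finset.card_univ] at h1
  refine h1.trans ?_
  have h2 : G.maxDegree - 1 = 0 := by omega
  have h3 : ∑ j ∈ Finset.range (Fintype.card V), (0 : ℕ) ^ j ≤ 1 := by
    cases Fintype.card V with
    | zero => simp
    | succ m => simp [Finset.sum_range_succ']
  rw [ballBound, h2]
  nlinarith

/-- The `k`-balanced tree of order `n`: the vertices are numbered level by level, so that the
children of `0` are `1, …, k` and the next vertices are taken `k - 1` at a time. -/
theorem exists_isBalancedTree {n k : ℕ} (hn : k < n) (hk : k ≤ 1 → n ≤ k + 1) :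
    ∃ B : SimpleGraph (Fin n), B.IsBalancedTree k := by
  have : NeZero n := ⟨by omega⟩
  have hq : ∀ i, (i - 2) / (k - 1) ≤ i := fun i => (Nat.div_le_self _ _).trans (Nat.sub_le _ _)
  have hlt : ∀ i, 0 < i → (i - 2) / (k - 1) < i := fun i hi =>
    (Nat.div_le_self _ _).trans_lt (by omega)
  have h := isParent_finParent n hq hlt
  have hzero : ((Finset.range n).filter fun j => j ≠ 0 ∧ (j - 2) / (k - 1) = 0) =
      Finset.Icc 1 k := by
    ext j
    simp only [Finset.mem_filter, Finset.mem_range, Finset.mem_Icc, Nat.div_eq_zero_iff]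
    omega
  have hpos : ∀ i, 0 < i → i < n →
      ((Finset.range n).filter fun j => j ≠ 0 ∧ (j - 2) / (k - 1) = i) =
        (Finset.Ico (i * (k - 1) + 2) (i * (k - 1) + 2 + (k - 1))).filter fun j => j < n := by
    intro i hi hin
    ext j
    rcases Nat.eq_zero_or_pos (k - 1) with hk2 | hk2
    · simp [hk2, hi.ne]
    simp only [Finset.mem_filter, Finset.mem_range, Finset.mem_Ico]
    have h1 : 0 < i * (k - 1) := Nat.mul_pos hi hk2
    rw [Nat.div_eq_iff hk2]
    omega
  have hdeg0 : (parentGraph (finParent n hq)).degree 0 = k := by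
    rw [h.parentGraph_degree, if_pos rfl, add_zero]
    exact ((card_children_finParent n hq (Fin.val_zero n)).trans
      (congrArg Finset.card hzero)).trans (by simp)
  have hdeg_ne : ∀ v : Fin n, 0 < (v : ℕ) → (parentGraph (finParent n hq)).degree v =
      ((Finset.Ico ((v : ℕ) * (k - 1) + 2) ((v : ℕ) * (k - 1) + 2 + (k - 1))).filter
        fun j => j < n).card + 1 := by
    intro v hv
    rw [h.parentGraph_degree, if_neg fun hc => by simp [hc] at hv]
    exact congrArg (· + 1) ((card_children_finParent n hq rfl).trans
      (congrArg Finset.card (hpos v hv v.2)))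
  refine ⟨parentGraph (finParent n hq), h.parentGraph_isTree, le_antisymm ?_ ?_, 0, ?_⟩
  · refine maxDegree_le_of_forall_degree_le _ _ fun v => ?_
    rcases Nat.eq_zero_or_pos (v : ℕ) with hv | hv
    · rw [show v = 0 from Fin.ext (by simpa using hv), hdeg0]
    · rw [hdeg_ne v hv]
      have h1 := Finset.card_filter_le
        (Finset.Ico ((v : ℕ) * (k - 1) + 2) ((v : ℕ) * (k - 1) + 2 + (k - 1))) (fun j => j < n)
      rw [Nat.card_Ico] at h1
      have := v.2
      omega
  · exact hdeg0.symm.trans_le (degree_le_maxDegree _ 0)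
  · intro z hz
    have hz' : ((((parentGraph (finParent n hq)).dist z 0 + 2 : ℕ)) : ℕ∞) ≤
        (parentGraph (finParent n hq)).eccent 0 := by
      exact_mod_cast hz
    obtain ⟨y, hy⟩ := (coe_le_eccent_iff h.parentGraph_connected).1 hz'
    rw [dist_comm, h.parentGraph_dist, h.parentGraph_dist] at hy
    rcases Nat.eq_zero_or_pos (z : ℕ) with hz0 | hz0
    · rw [show z = 0 from Fin.ext (by simpa using hz0), hdeg0]
    have hk2 : 0 < k - 1 := by
      by_contra hc
      have h1 := h.level_lt_card y
      rw [Fintype.card_fin] at h1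
      have := hk (by omega)
      omega
    have hy0 : 0 < (y : ℕ) := Nat.pos_of_ne_zero fun hc => by
      rw [hc] at hy
      simp [depth] at hy
    -- The parent of `y` is on a later level than `z`, hence it comes after `z`, and so all
    -- children of `z` come before `y`.
    have hlater : (z : ℕ) < (y - 2) / (k - 1) := by
      by_contra hc
      have hmono : Monotone fun i => (i - 2) / (k - 1) := fun i j hij =>
        Nat.div_le_div_right (Nat.sub_le_sub_right hij 2)
      have h1 := depth_mono hlt hmono (not_lt.1 hc)
      have h2 := depth_of_lt (q := fun i => (i - 2) / (k - 1)) (hlt y hy0)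
      omega
    have hzy : ((z : ℕ) + 1) * (k - 1) ≤ y - 2 := (Nat.le_div_iff_mul_le hk2).1 hlater
    rw [hdeg_ne z hz0, Finset.filter_true_of_mem, Nat.card_Ico]
    · omega
    · intro j hj
      rw [Finset.mem_Ico] at hj
      have := y.2
      rw [add_mul, one_mul] at hzy
      omega

end

section

open scoped Classical

variable {V : Type*} [Fintype V]

/-! ### Subtree sizes and the upper bound -/

/-- The number of edges of the tree with parent function `p` and root `r` whose removal leaves at
least `j` vertices on either side; the edge from `v` to its parent is represented by `v`. -/
noncomputable def deepEdges (p : V → V) (r : V) (j : ℕ) : ℕ :=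
  (Finset.univ.filter fun v =>
    v ≠ r ∧ j ≤ (desc p v).card ∧ (desc p v).card + j ≤ Fintype.card V).card

theorem card_le_deepEdges {p : V → V} {r : V} {j : ℕ} {s : Finset ℕ} {f : ℕ → V}
    (hf : ∀ i ∈ s, f i ≠ r ∧ j ≤ (desc p (f i)).card ∧ (desc p (f i)).card + j ≤ Fintype.card V)
    (hinj : Set.InjOn f s) : s.card ≤ deepEdges p r j :=
  Finset.card_le_card_of_injOn f (fun i hi => by simpa using hf i hi) hinj

/-- An edge with `m` vertices on its smaller side is deep for `j = 1, …, m`. -/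
theorem sum_min_desc_card (p : V → V) (r : V) :
    ∑ v ∈ Finset.univ.erase r, min (desc p v).card (Fintype.card V - (desc p v).card) =
      ∑ j ∈ Finset.Icc 1 (Fintype.card V), deepEdges p r j := by
  have h1 : ∀ v, min (desc p v).card (Fintype.card V - (desc p v).card) =
      ∑ j ∈ Finset.Icc 1 (Fintype.card V),
        if j ≤ (desc p v).card ∧ (desc p v).card + j ≤ Fintype.card V then 1 else 0 := by
    intro v
    rw [← Finset.card_filter]
    have : ((Finset.Icc 1 (Fintype.card V)).filter fun j =>
        j ≤ (desc p v).card ∧ (desc p v).card + j ≤ Fintype.card V) =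
        Finset.Icc 1 (min (desc p v).card (Fintype.card V - (desc p v).card)) := by
      ext j
      simp only [Finset.mem_filter, Finset.mem_Icc]
      omega
    rw [this, Nat.card_Icc, Nat.add_sub_cancel]
  rw [Finset.sum_congr rfl fun v _ => h1 v, Finset.sum_comm]
  refine Finset.sum_congr rfl fun j _ => ?_
  rw [← Finset.card_filter, deepEdges]
  congr 1
  ext v
  simp

namespace IsParent

variable {p : V → V} {r : V} {l : V → ℕ} (h : IsParent p r l)
include h

theorem sum_sepDist_eq (x : V) :
    ∑ y, sepDist p x y = ∑ v ∈ Finset.univ.erase r,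
      if Anc p v x then Fintype.card V - (desc p v).card else (desc p v).card := by
  rw [sum_sepDist, ← Finset.add_sum_erase _ _ (Finset.mem_univ r), if_pos (h.anc_root x),
    h.desc_root]
  simp

/-- The status is attained at a centroid, for which every edge has its smaller side on the side
away from the centroid. -/
theorem status_le_sum_deepEdges {G : SimpleGraph V} (hG : G.Connected)
    (hadj : ∀ v, v ≠ r → G.Adj v (p v)) :
    G.status ≤ ∑ j ∈ Finset.Icc 1 (Fintype.card V), deepEdges p r j := by
  have hn : 0 < Fintype.card V := Fintype.card_pos_iff.2 ⟨r⟩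
  -- The centroid is the root of a smallest subtree with more than half of the vertices.
  obtain ⟨c, hc, hmin⟩ := Finset.exists_min_image
    (Finset.univ.filter fun v => Fintype.card V < 2 * (desc p v).card) (fun v => (desc p v).card)
    ⟨r, by simp [h.desc_root]; omega⟩
  simp only [Finset.mem_filter, Finset.mem_univ, true_and] at hc hmin
  rw [← sum_min_desc_card]
  refine (G.status_le_vertexStatus c).trans
    ((Finset.sum_le_sum fun y _ => h.dist_le_sepDist hG hadj c y).trans ?_)
  rw [h.sum_sepDist_eq]
  refine Finset.sum_le_sum fun v _ => ?_
  split_ifs with hv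
  · have := Finset.card_le_card (desc_subset hv)
    omega
  · have hle : 2 * (desc p v).card ≤ Fintype.card V := by
      by_contra hlt
      have h1 := hmin v (by omega)
      by_cases hcv : Anc p c v
      · have := h.desc_card_lt hcv fun hc => hv (hc ▸ .refl _ _)
        omega
      · have := (Finset.card_union_of_disjoint (desc_disjoint hv hcv)).symm.trans_le
          (Finset.card_le_univ _)
        omega
    omega

/-- From every vertex, each edge is crossed at least as often as its smaller side has vertices. -/
theorem sum_deepEdges_le_status :
    ∑ j ∈ Finset.Icc 1 (Fintype.card V), deepEdges p r j ≤ (parentGraph p).status := by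
  have : Nonempty V := ⟨r⟩
  obtain ⟨x, hx⟩ := (parentGraph p).exists_vertexStatus_eq_status
  rw [← hx, ← sum_min_desc_card]
  refine le_trans ?_ (Finset.sum_le_sum fun y _ => h.sepDist_le_dist x y)
  rw [h.sum_sepDist_eq]
  refine Finset.sum_le_sum fun v _ => ?_
  split_ifs <;> omega

theorem desc_card_lt_card {v : V} (hv : v ≠ r) : (desc p v).card < Fintype.card V := by
  have := h.desc_card_lt (h.anc_root v) hv.symm
  rwa [h.desc_root, Finset.card_univ] at this

theorem deepEdges_one : deepEdges p r 1 = Fintype.card V - 1 := by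
  rw [deepEdges, ← Finset.card_univ, ← Finset.card_erase_of_mem (Finset.mem_univ r)]
  congr 1
  ext v
  simp only [Finset.mem_filter, Finset.mem_univ, true_and, Finset.mem_erase, and_true,
    and_iff_left_iff_imp]
  intro hv
  exact ⟨desc_card_pos p v, h.desc_card_lt_card hv⟩

/-- Below every subtree with at least `j` vertices there is a lowest one. -/
theorem exists_lowest {j : ℕ} {v : V} (hv : j ≤ (desc p v).card) :
    ∃ u, Anc p v u ∧ j ≤ (desc p u).card ∧ ∀ x, Anc p u x → x ≠ u → (desc p x).card < j := by
  obtain ⟨u, hu, hmin⟩ := Finset.exists_min_image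
    ((desc p v).filter fun x => j ≤ (desc p x).card) (fun x => (desc p x).card)
    ⟨v, by simp [hv, Anc.refl]⟩
  simp only [Finset.mem_filter, mem_desc] at hu hmin
  refine ⟨u, hu.1, hu.2, fun x hx hne => ?_⟩
  by_contra hc
  have h1 := hmin x ⟨hu.1.trans hx, by omega⟩
  have h2 := h.desc_card_lt hx hne.symm
  omega

theorem exists_leaf (v : V) : ∃ u, Anc p v u ∧ (desc p u).card = 1 := by
  obtain ⟨u, h1, -, h3⟩ := h.exists_lowest (j := 1) (desc_card_pos p v)
  refine ⟨u, h1, Finset.card_eq_one.2 ⟨u, ?_⟩⟩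
  refine Finset.eq_singleton_iff_unique_mem.2 ⟨self_mem_desc p u, fun x hx => ?_⟩
  by_contra hne
  have h4 := h3 x (mem_desc.1 hx) hne
  have h5 := desc_card_pos p x
  omega

theorem level_children_root {x : V} (hx : x ∈ children p r r) : l x = 1 := by
  obtain ⟨h1, h2⟩ := mem_children.1 hx
  rw [← h.level x h1, h2, h.level_root]

omit [Fintype V] in
theorem ne_root_of_anc {u v : V} (hu : u ≠ r) (huv : Anc p u v) : v ≠ r := by
  rintro rfl
  exact hu (h.antisymm huv (h.anc_root u))

/-- Small subtrees: those below a lowest vertex `u` with a large subtree, and at least one in each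
of the branches at the root that do not contain `u`. -/
theorem card_small_ge {j : ℕ} (hj : 2 ≤ j) {u : V} (hur : u ≠ r)
    (hu : ∀ x, Anc p u x → x ≠ u → (desc p x).card < j) :
    ((desc p u).card - 1) + ((children p r r).card - 1) ≤
      (Finset.univ.filter fun v => v ≠ r ∧ (desc p v).card < j).card := by
  choose leaf hleaf using h.exists_leaf
  -- `b` is the child of the root whose branch contains `u`.
  have hlu : 1 ≤ l u := Nat.one_le_iff_ne_zero.2 fun hc => hur (h.level_eq_zero.1 hc)
  obtain ⟨b, hbu, hb⟩ := h.exists_anc_level u hlu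
  have hbranch : ∀ x ∈ children p r r, ∀ y ∈ children p r r, ∀ z, Anc p x z → Anc p y z → x = y :=
    fun x hx y hy z hxz hyz => h.eq_of_anc_of_anc hxz hyz
      ((h.level_children_root hx).trans (h.level_children_root hy).symm)
  have hbr : b ≠ r := h.ne_root hb
  have hbc : b ∈ children p r r := by
    refine mem_children.2 ⟨hbr, h.level_eq_zero.1 ?_⟩
    have := h.level b hbr
    omega
  have hdisj : Disjoint ((desc p u).erase u) (((children p r r).erase b).image leaf) := by
    rw [Finset.disjoint_left]
    intro y hy hy'
    obtain ⟨x, hx, rfl⟩ := Finset.mem_image.1 hy'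
    rw [Finset.mem_erase] at hx hy
    exact hx.1 (hbranch x hx.2 b hbc _ (hleaf x).1 (hbu.trans (mem_desc.1 hy.2)))
  rw [← Finset.card_erase_of_mem (self_mem_desc p u), ← Finset.card_erase_of_mem hbc,
    ← Finset.card_image_of_injOn (s := (children p r r).erase b) (f := leaf),
    ← Finset.card_union_of_disjoint hdisj]
  · refine Finset.card_le_card fun y hy => ?_
    simp only [Finset.mem_filter, Finset.mem_univ, true_and]
    rcases Finset.mem_union.1 hy with hy | hy
    · rw [Finset.mem_erase, mem_desc] at hy
      exact ⟨h.ne_root_of_anc hur hy.2, hu y hy.2 hy.1⟩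
    · obtain ⟨x, hx, rfl⟩ := Finset.mem_image.1 hy
      refine ⟨h.ne_root_of_anc (mem_children.1 (Finset.mem_of_mem_erase hx)).1 (hleaf x).1, ?_⟩
      rw [(hleaf x).2]
      omega
  · intro x hx y hy hxy
    have hx' := Finset.mem_of_mem_erase (Finset.mem_coe.1 hx)
    have hy' := Finset.mem_of_mem_erase (Finset.mem_coe.1 hy)
    exact hbranch x hx' y hy' _ (hleaf x).1 (hxy ▸ (hleaf y).1)

omit h in
theorem card_large_add_card_small (p : V → V) (r : V) (j : ℕ) :
    (Finset.univ.filter fun v => v ≠ r ∧ j ≤ (desc p v).card).card +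
      (Finset.univ.filter fun v => v ≠ r ∧ (desc p v).card < j).card + 1 = Fintype.card V := by
  rw [← Finset.card_union_of_disjoint, ← Finset.card_univ,
    ← Finset.card_erase_add_one (Finset.mem_univ r)]
  · congr 2
    ext v
    simp only [Finset.mem_union, Finset.mem_filter, Finset.mem_univ, true_and, Finset.mem_erase,
      and_true]
    have := le_or_gt j (desc p v).card
    tauto
  · rw [Finset.disjoint_filter]
    intros
    omega

omit h in
theorem deepEdges_le_card_large (p : V → V) (r : V) (j : ℕ) :
    deepEdges p r j ≤ (Finset.univ.filter fun v => v ≠ r ∧ j ≤ (desc p v).card).card := by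
  refine Finset.card_le_card fun v hv => ?_
  simp only [Finset.mem_filter, Finset.mem_univ, true_and] at hv ⊢
  exact ⟨hv.1, hv.2.1⟩

theorem deepEdges_le_sub_children {j : ℕ} (hj : 2 ≤ j) (hr : 0 < (children p r r).card) :
    deepEdges p r j ≤ Fintype.card V + 1 - j - (children p r r).card := by
  rcases Nat.eq_zero_or_pos (deepEdges p r j) with h0 | h0
  · omega
  obtain ⟨v, hv⟩ := Finset.card_pos.1 h0
  simp only [Finset.mem_filter, Finset.mem_univ, true_and] at hv
  obtain ⟨u, hvu, hju, hu⟩ := h.exists_lowest hv.2.1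
  have h1 := h.card_small_ge hj (h.ne_root_of_anc hv.1 hvu) hu
  have h2 := card_large_add_card_small p r j
  have h3 := deepEdges_le_card_large p r j
  omega

/-- If the deep edges lie on one path from the root, then they all lie between the part below the
lowest one and the part above the highest one. If not, then there are two lowest ones. In both
cases, this leaves two disjoint sets of `j - 1` vertices, and one vertex more, that do not represent
deep edges. -/
theorem deepEdges_le_sub_two_mul {j : ℕ} (hj : 2 ≤ j) :
    deepEdges p r j ≤ Fintype.card V + 1 - j - j := by
  rcases Nat.eq_zero_or_pos (deepEdges p r j) with h0 | h0
  · omega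
  set W := Finset.univ.filter fun v =>
    v ≠ r ∧ j ≤ (desc p v).card ∧ (desc p v).card + j ≤ Fintype.card V with hW
  have hmem : ∀ v, v ∈ W ↔ v ≠ r ∧ j ≤ (desc p v).card ∧ (desc p v).card + j ≤ Fintype.card V := by
    intro v
    simp [hW]
  change W.card ≤ _
  change 0 < W.card at h0
  have hdisj : ∀ u, (∀ x, Anc p u x → x ≠ u → (desc p x).card < j) →
      Disjoint W ((desc p u).erase u) := by
    intro u hu
    rw [Finset.disjoint_left]
    intro x hx hx'
    rw [Finset.mem_erase, mem_desc] at hx'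
    have h1 := hu x hx'.2 hx'.1
    have h2 := (hmem x).1 hx
    omega
  have hcard : ∀ u, j ≤ (desc p u).card → j ≤ ((desc p u).erase u).card + 1 := by
    intro u hu
    rwa [Finset.card_erase_add_one (self_mem_desc p u)]
  by_cases hchain : ∀ u ∈ W, ∀ v ∈ W, Anc p u v ∨ Anc p v u
  · obtain ⟨t, ht, hmax⟩ := Finset.exists_max_image W (fun v => (desc p v).card)
      (Finset.card_pos.1 h0)
    obtain ⟨u, htu, hju, hu⟩ := h.exists_lowest ((hmem t).1 ht).2.1
    have hsub : W ∪ (desc p u).erase u ⊆ desc p t := by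
      refine Finset.union_subset (fun v hv => mem_desc.2 ?_)
        ((Finset.erase_subset _ _).trans (desc_subset htu))
      rcases hchain t ht v hv with h1 | h1
      · exact h1
      · by_cases hne : v = t
        · exact hne ▸ .refl _ _
        · have h2 := h.desc_card_lt h1 hne
          have h3 := hmax v hv
          omega
    have h1 := Finset.card_le_card hsub
    rw [Finset.card_union_of_disjoint (hdisj u hu)] at h1
    have h2 := hcard u hju
    have h3 := (hmem t).1 ht
    omega
  · push Not at hchain
    obtain ⟨a, ha, b, hb, hab, hba⟩ := hchain
    obtain ⟨u, hau, hju, hu⟩ := h.exists_lowest ((hmem a).1 ha).2.1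
    obtain ⟨v, hbv, hjv, hv⟩ := h.exists_lowest ((hmem b).1 hb).2.1
    have huv : Disjoint ((desc p u).erase u) ((desc p v).erase v) :=
      (desc_disjoint hab hba).mono ((Finset.erase_subset _ _).trans (desc_subset hau))
        ((Finset.erase_subset _ _).trans (desc_subset hbv))
    have hsub : (W ∪ (desc p u).erase u) ∪ (desc p v).erase v ⊆ Finset.univ.erase r := by
      intro x hx
      rw [Finset.mem_erase]
      refine ⟨?_, Finset.mem_univ x⟩
      simp only [Finset.mem_union, Finset.mem_erase, mem_desc] at hx
      rcases hx with (hx | hx) | hx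
      · exact ((hmem x).1 hx).1
      · exact h.ne_root_of_anc ((hmem a).1 ha).1 (hau.trans hx.2)
      · exact h.ne_root_of_anc ((hmem b).1 hb).1 (hbv.trans hx.2)
    have h1 := Finset.card_le_card hsub
    rw [Finset.card_union_of_disjoint (Finset.disjoint_union_left.2 ⟨hdisj v hv, huv⟩),
      Finset.card_union_of_disjoint (hdisj u hu), Finset.card_erase_of_mem (Finset.mem_univ r),
      Finset.card_univ] at h1
    have h2 := hcard u hju
    have h3 := hcard v hjv
    omega

/-- If there are as many deep edges as possible for `j = 2, 3`, then there is only one subtree with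
two vertices, so that all larger subtrees contain it, and the vertices above it form a long path. -/
theorem exists_level_ge {k : ℕ} (hk : 3 ≤ k) (hkn : k < Fintype.card V)
    (hr : (children p r r).card = k) (h2 : Fintype.card V ≤ deepEdges p r 2 + k + 1)
    (h3 : Fintype.card V ≤ deepEdges p r 3 + k + 2) : ∃ v, Fintype.card V ≤ l v + k := by
  obtain ⟨b, hb⟩ : (children p r r).Nonempty := Finset.card_pos.1 (by omega)
  by_cases hnk : Fintype.card V ≤ k + 1
  · exact ⟨b, by rw [h.level_children_root hb]; omega⟩
  have hupper := h.deepEdges_le_sub_children le_rfl (by omega : 0 < (children p r r).card)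
  -- Subtrees with two vertices are counted for `2` but not for `3`.
  have htwo : (Finset.univ.filter fun v => v ≠ r ∧ (desc p v).card = 2).card ≤ 1 := by
    have : (Finset.univ.filter fun v => v ≠ r ∧ (desc p v).card = 2).card + deepEdges p r 3 ≤
        deepEdges p r 2 := by
      unfold deepEdges
      rw [← Finset.card_union_of_disjoint]
      · refine Finset.card_le_card fun v hv => ?_
        simp only [Finset.mem_union, Finset.mem_filter, Finset.mem_univ, true_and] at hv ⊢
        rcases hv with hv | hv <;> exact ⟨hv.1, by omega, by omega⟩
      · rw [Finset.disjoint_filter]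
        intros
        omega
    omega
  have hsplit := card_large_add_card_small p r 2
  have hlarge := deepEdges_le_card_large p r 2
  set U := Finset.univ.filter fun v => v ≠ r ∧ 2 ≤ (desc p v).card with hU
  have hmem : ∀ v, v ∈ U ↔ v ≠ r ∧ 2 ≤ (desc p v).card := by
    intro v
    simp [hU]
  -- There are at most `k` leaves, and each of the other `k - 1` branches has one of them, so that a
  -- lowest subtree with more than one vertex has only one leaf.
  have hlow : ∀ v ∈ U, ∃ u, Anc p v u ∧ u ≠ r ∧ (desc p u).card = 2 := by
    intro v hv
    obtain ⟨hvr, hv2⟩ := (hmem v).1 hv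
    obtain ⟨u, hvu, hju, hu⟩ := h.exists_lowest hv2
    have hur := h.ne_root_of_anc hvr hvu
    have := h.card_small_ge le_rfl hur hu
    exact ⟨u, hvu, hur, by omega⟩
  obtain ⟨v0, hv0⟩ : U.Nonempty := Finset.card_pos.1 (by omega)
  obtain ⟨q, -, hqr, hq⟩ := hlow v0 hv0
  have hanc : ∀ v ∈ U, Anc p v q := by
    intro v hv
    obtain ⟨u, hvu, hur, hu⟩ := hlow v hv
    rwa [Finset.card_le_one.1 htwo q (by simp [hqr, hq]) u (by simp [hur, hu])]
  obtain ⟨x, hx, hxq⟩ := Finset.exists_mem_ne (s := desc p q) (by omega) q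
  rw [mem_desc] at hx
  have hxU : x ∉ U := by
    rw [hmem]
    have := h.desc_card_lt hx hxq.symm
    omega
  have hxr := h.ne_root_of_anc hqr hx
  have hancx : ∀ v ∈ insert x U, Anc p v x ∧ v ≠ r := by
    intro v hv
    rcases Finset.mem_insert.1 hv with rfl | hv
    · exact ⟨.refl _ _, hxr⟩
    · exact ⟨(hanc v hv).trans hx, ((hmem v).1 hv).1⟩
  -- `x` is the leaf below `q`; the vertices counted are on different levels, up to that of `x`.
  have hcount : (insert x U).card ≤ (Finset.Icc 1 (l x)).card := by
    refine Finset.card_le_card_of_injOn l (fun v hv => ?_) fun v hv w hw hvw => ?_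
    · obtain ⟨h1, h2⟩ := hancx v hv
      have h3 : l v ≠ 0 := fun hc => h2 (h.level_eq_zero.1 hc)
      exact Finset.mem_coe.2 (Finset.mem_Icc.2 ⟨Nat.one_le_iff_ne_zero.2 h3, h.level_le h1⟩)
    · exact h.eq_of_anc_of_anc (hancx v hv).1 (hancx w hw).1 hvw
  rw [Finset.card_insert_of_notMem hxU, Nat.card_Icc] at hcount
  exact ⟨x, by omega⟩

end IsParent

/-! ### The comet -/

/-- The parent function of the comet with centre `0`, leaves `1, …, k - 1` and tail
`0, k, k + 1, …`. -/
def cometParent (k i : ℕ) : ℕ := if i ≤ k then 0 else i - 1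

theorem cometParent_le (k i : ℕ) : cometParent k i ≤ i := by
  unfold cometParent
  split_ifs <;> omega

theorem cometParent_lt (k i : ℕ) (hi : 0 < i) : cometParent k i < i := by
  unfold cometParent
  split_ifs <;> omega

/-- The comet of order `n` and maximum degree `k`. -/
def cometGraph (n k : ℕ) : SimpleGraph (Fin n) := parentGraph (finParent n (cometParent_le k))

theorem isParent_comet (n k : ℕ) [NeZero n] : IsParent (finParent n (cometParent_le k)) 0
    fun i => depth (cometParent k) i :=
  isParent_finParent n (cometParent_le k) (cometParent_lt k)

theorem finParent_anc_le {n : ℕ} {q : ℕ → ℕ} (hq : ∀ i, q i ≤ i) {u v : Fin n}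
    (huv : Anc (finParent n hq) u v) : u ≤ v := by
  obtain ⟨m, rfl⟩ := huv
  induction m generalizing v with
  | zero => exact le_rfl
  | succ m ih => exact ih.trans (Fin.mk_le_mk.2 (hq v))

theorem comet_anc {n k : ℕ} {u v : Fin n} (hk : k ≤ u) (huv : u ≤ v) :
    Anc (finParent n (cometParent_le k)) u v := by
  induction hm : (v : ℕ) - u generalizing v with
  | zero =>
    have : u = v := Fin.ext (by have := Fin.le_def.1 huv; omega)
    exact this ▸ .refl _ _
  | succ m ih =>
    rw [anc_iff]
    have h1 : ((finParent n (cometParent_le k) v : Fin n) : ℕ) = v - 1 := by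
      simp only [finParent, cometParent]
      rw [if_neg (by omega)]
    exact .inr (ih (Fin.le_def.2 (by omega)) (by omega))

theorem comet_desc_card {n k : ℕ} {u : Fin n} (hk : k ≤ u) :
    (desc (finParent n (cometParent_le k)) u).card = n - u := by
  rw [← Fin.card_Ici]
  congr 1
  ext v
  rw [mem_desc, Finset.mem_Ici]
  exact ⟨finParent_anc_le _, comet_anc hk⟩

/-- The tail of the comet alone has this many deep edges. -/
theorem le_deepEdges_comet {n k : ℕ} [NeZero n] (hk : 0 < k) {j : ℕ} (hj : 0 < j) :
    n + 1 - j - max j k ≤ deepEdges (finParent n (cometParent_le k)) 0 j := by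
  have h1 : (Finset.Icc (max j k) (n - j)).card ≤
      deepEdges (finParent n (cometParent_le k)) 0 j := by
    have hval : ∀ i ∈ Finset.Icc (max j k) (n - j), (Fin.ofNat n i : ℕ) = i ∧ i ≠ 0 := by
      intro i hi
      rw [Finset.mem_Icc] at hi
      exact ⟨Nat.mod_eq_of_lt (by omega), by omega⟩
    refine card_le_deepEdges (f := Fin.ofNat n) (fun i hi => ?_) fun i hi i' hi' hii => ?_
    · obtain ⟨h1, h2⟩ := hval i hi
      rw [Finset.mem_Icc] at hi
      rw [comet_desc_card (by omega), h1, Fintype.card_fin]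
      refine ⟨fun hc => h2 ?_, by omega, by omega⟩
      rw [← h1, hc, Fin.val_zero]
    · rw [← (hval i hi).1, hii, (hval i' hi').1]
  rw [Nat.card_Icc] at h1
  omega

end

section

open scoped Classical

theorem cometGraph_degree_zero {n k : ℕ} [NeZero n] (hk : 0 < k) (hkn : k < n) :
    (cometGraph n k).degree 0 = k := by
  have h1 : ((Finset.range n).filter fun j => j ≠ 0 ∧ cometParent k j = 0) = Finset.Icc 1 k := by
    ext j
    rw [Finset.mem_filter, Finset.mem_range, Finset.mem_Icc, cometParent]
    split_ifs <;> omega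
  unfold cometGraph
  rw [(isParent_comet n k).parentGraph_degree, if_pos rfl, add_zero]
  exact ((card_children_finParent n _ (Fin.val_zero n)).trans
    (congrArg Finset.card h1)).trans (by simp)

theorem cometGraph_degree_le {n k : ℕ} [NeZero n] {v : Fin n} (hv : v ≠ 0) :
    (cometGraph n k).degree v ≤ if (v : ℕ) < k then 1 else 2 := by
  have hv' : (v : ℕ) ≠ 0 := fun hc => hv (Fin.ext (by simpa using hc))
  have h1 : ((Finset.range n).filter fun j => j ≠ 0 ∧ cometParent k j = v) ⊆
      if (v : ℕ) < k then ∅ else {(v : ℕ) + 1} := by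
    intro j
    rw [Finset.mem_filter, Finset.mem_range, cometParent]
    split_ifs <;> simp <;> omega
  have h2 := Finset.card_le_card h1
  have h3 := card_children_finParent n (cometParent_le k) (i := v) rfl
  unfold cometGraph
  rw [(isParent_comet n k).parentGraph_degree, if_neg hv, h3]
  split_ifs at h2 ⊢ with hvk <;> simp at h2 ⊢
  · exact h2
  · exact h2

theorem cometGraph_adj_parent {n k : ℕ} [NeZero n] {v : Fin n} (hv : v ≠ 0) :
    (cometGraph n k).Adj v (finParent n (cometParent_le k) v) :=
  (isParent_comet n k).parentGraph_adj_parent hv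

theorem cometGraph_adj_zero {n k : ℕ} [NeZero n] {v : Fin n} (hv : v ≠ 0) (hvk : (v : ℕ) ≤ k) :
    (cometGraph n k).Adj v 0 := by
  have h1 : finParent n (cometParent_le k) v = 0 := Fin.ext (by simp [finParent, cometParent, hvk])
  exact h1 ▸ cometGraph_adj_parent (k := k) hv

/-- The walk from `v` down the tail to the centre of the comet. -/
theorem exists_isPath_cometGraph {n k : ℕ} [NeZero n] (hk : 0 < k) (v : Fin n) (hv : k ≤ v) :
    ∃ q : (cometGraph n k).Walk v 0, q.IsPath ∧ q.length + k = v + 1 ∧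
      ∀ u ∈ q.support, u = 0 ∨ k ≤ (u : ℕ) ∧ u ≤ v := by
  induction hm : (v : ℕ) - k generalizing v with
  | zero =>
    have hv0 : v ≠ 0 := by
      rintro rfl
      simp at hv
      omega
    have hadj : (cometGraph n k).Adj v 0 := cometGraph_adj_zero hv0 (by omega)
    refine ⟨hadj.toWalk, hadj.isPath_toWalk, by simp; omega, ?_⟩
    intro u hu
    simp only [Adj.toWalk, Walk.support_cons, Walk.support_nil, List.mem_cons,
      List.not_mem_nil, or_false] at hu
    rcases hu with rfl | rfl
    · exact .inr ⟨hv, le_rfl⟩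
    · exact .inl rfl
  | succ m ih =>
    have hv0 : v ≠ 0 := by
      rintro rfl
      simp at hv
      omega
    have hval : ((finParent n (cometParent_le k) v : Fin n) : ℕ) = v - 1 := by
      simp only [finParent, cometParent]
      rw [if_neg (by omega)]
    obtain ⟨q, hq, hlen, hsupp⟩ := ih (finParent n (cometParent_le k) v) (by omega) (by omega)
    have hadj := cometGraph_adj_parent (k := k) hv0
    refine ⟨Walk.cons hadj q, (Walk.cons_isPath_iff _ _).2 ⟨hq, fun hc => ?_⟩, ?_, ?_⟩
    · rcases hsupp v hc with h1 | h1
      · exact hv0 h1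
      · have := Fin.le_def.1 h1.2
        omega
    · rw [Walk.length_cons]
      omega
    · intro u hu
      rw [Walk.support_cons, List.mem_cons] at hu
      rcases hu with rfl | hu
      · exact .inr ⟨hv, le_rfl⟩
      · refine (hsupp u hu).imp_right fun h1 => ⟨h1.1, Fin.le_def.2 ?_⟩
        have := Fin.le_def.1 h1.2
        omega

theorem cometGraph_isTree (n k : ℕ) [NeZero n] : (cometGraph n k).IsTree :=
  (isParent_comet n k).parentGraph_isTree

theorem cometGraph_isComet {n k : ℕ} (hn : 3 ≤ n) (hk : 2 ≤ k) (hkn : k < n) :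
    (cometGraph n k).IsComet k := by
  have : NeZero n := ⟨by omega⟩
  have hdeg0 : (cometGraph n k).degree 0 = k := cometGraph_degree_zero (by omega) hkn
  refine ⟨by simpa using hn, hk, cometGraph_isTree n k, le_antisymm ?_ ?_, 0, hdeg0, ?_, ?_⟩
  · refine maxDegree_le_of_forall_degree_le _ _ fun v => ?_
    by_cases hv : v = 0
    · rw [hv, hdeg0]
    · refine (cometGraph_degree_le hv).trans ?_
      split_ifs <;> omega
  · exact hdeg0.symm.trans_le (degree_le_maxDegree _ 0)
  · obtain ⟨q, hq, hlen, hsupp⟩ := exists_isPath_cometGraph (n := n) (k := k) (by omega)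
      ⟨n - 1, by omega⟩ (by simp; omega)
    have hadj : (cometGraph n k).Adj 0 ⟨1, by omega⟩ :=
      (cometGraph_adj_zero (fun hc => by simpa using congrArg Fin.val hc) (by simp; omega)).symm
    refine ⟨_, _, q.concat hadj, hq.concat (fun hc => ?_) hadj, ?_, ?_⟩
    · rcases hsupp _ hc with h1 | h1
      · simpa using congrArg Fin.val h1
      · have := h1.1
        simp only at this
        omega
    · rw [Walk.length_concat, Fintype.card_fin]
      simp only at hlen
      omega
    · rw [Walk.support_concat]
      simp
  · have h1 : (Finset.Ioo (0 : Fin n) ⟨k, hkn⟩).card = k - 1 := by simp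
    rw [← h1]
    refine Finset.card_le_card fun u hu => ?_
    rw [Finset.mem_Ioo] at hu
    have hu0 : u ≠ 0 := hu.1.ne'
    have huk : (u : ℕ) < k := Fin.lt_def.1 hu.2
    have hadj : (cometGraph n k).Adj u 0 := cometGraph_adj_zero hu0 huk.le
    rw [Finset.mem_filter, mem_neighborFinset]
    refine ⟨hadj.symm, le_antisymm ?_ (hadj.degree_pos_left)⟩
    have := cometGraph_degree_le (k := k) hu0
    rwa [if_pos huk] at this

/-- A comet is found in a graph from its tail `x 0, x 1, …`, starting at the centre, and its other
leaves. -/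
theorem cometGraph_isContained {W : Type*} {G : SimpleGraph W} {n k : ℕ} (hk : 1 ≤ k) (hkn : k < n)
    (x : ℕ → W) (hinj : Set.InjOn x (Set.Iic (n - k)))
    (hadj : ∀ i < n - k, G.Adj (x i) (x (i + 1))) (A : Finset W) (hA : A.card = k - 1)
    (hxA : ∀ a ∈ A, G.Adj (x 0) a) (hdisj : ∀ i ≤ n - k, x i ∉ A) : cometGraph n k ⊑ G := by
  have : NeZero n := ⟨by omega⟩
  obtain ⟨a, haA, hainj⟩ : ∃ a : ℕ → W, (∀ i < k - 1, a i ∈ A) ∧ Set.InjOn a (Set.Iio (k - 1)) := by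
    let g := (A.equivFinOfCardEq hA).symm
    refine ⟨fun i => if hi : i < k - 1 then g ⟨i, hi⟩ else x 0, fun i hi => ?_,
      fun i hi j hj hij => ?_⟩
    · simp only [dif_pos hi]
      exact (g ⟨i, hi⟩).2
    · rw [Set.mem_Iio] at hi hj
      simp only [dif_pos hi, dif_pos hj] at hij
      simpa using g.injective (Subtype.ext hij)
  let e : Fin n → W := fun i =>
    if (i : ℕ) = 0 then x 0 else if (i : ℕ) < k then a (i - 1) else x (i + 1 - k)
  have he0 : ∀ i : Fin n, (i : ℕ) = 0 → e i = x 0 := fun i hi => if_pos hi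
  have hea : ∀ i : Fin n, (i : ℕ) ≠ 0 → (i : ℕ) < k → e i = a (i - 1) := fun i hi hik =>
    (if_neg hi).trans (if_pos hik)
  have hex : ∀ i : Fin n, k ≤ (i : ℕ) → e i = x (i + 1 - k) := fun i hik =>
    (if_neg (by omega)).trans (if_neg (by omega))
  have hpar : ∀ v : Fin n, v ≠ 0 → G.Adj (e v) (e (finParent n (cometParent_le k) v)) := by
    intro v hv
    have hv0 : (v : ℕ) ≠ 0 := fun hc => hv (Fin.ext (by simpa using hc))
    rcases le_or_gt (v : ℕ) k with hvk | hvk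
    · have h1 : finParent n (cometParent_le k) v = 0 :=
        Fin.ext (by simp [finParent, cometParent, hvk])
      rw [h1, he0 0 (Fin.val_zero n)]
      rcases hvk.lt_or_eq with hvk | hvk
      · rw [hea v hv0 hvk]
        exact (hxA _ (haA _ (by omega))).symm
      · rw [hex v hvk.ge, hvk, Nat.add_sub_cancel_left]
        exact (hadj 0 (by omega)).symm
    · have h1 : ((finParent n (cometParent_le k) v : Fin n) : ℕ) = v - 1 := by
        simp only [finParent, cometParent]
        rw [if_neg (by omega)]
      rw [hex v hvk.le, hex _ (by omega), h1, show (v : ℕ) - 1 + 1 - k = v - k by omega,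
        show (v : ℕ) + 1 - k = v - k + 1 by omega]
      exact (hadj _ (by have := v.2; omega)).symm
  have hxa : ∀ i ≤ n - k, ∀ j < k - 1, x i ≠ a j := fun i hi j hj hc =>
    hdisj i hi (hc ▸ haA j hj)
  have hle : cometGraph n k ≤ G.comap e :=
    (isParent_comet n k).parentGraph_le (G := G.comap e) hpar
  refine ⟨⟨⟨e, fun hab => hle hab⟩, fun i j hij => ?_⟩⟩
  change e i = e j at hij
  have hi := i.2
  have hj := j.2
  apply Fin.ext
  rcases Nat.eq_zero_or_pos (i : ℕ) with hi0 | hi0 <;>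
    rcases Nat.eq_zero_or_pos (j : ℕ) with hj0 | hj0
  · omega
  · rw [he0 i hi0] at hij
    rcases lt_or_ge (j : ℕ) k with hjk | hjk
    · rw [hea j hj0.ne' hjk] at hij
      exact absurd hij (hxa _ (by omega) _ (by omega))
    · rw [hex j hjk] at hij
      have := hinj (Set.mem_Iic.2 (by omega)) (Set.mem_Iic.2 (by omega)) hij
      omega
  · rw [he0 j hj0] at hij
    rcases lt_or_ge (i : ℕ) k with hik | hik
    · rw [hea i hi0.ne' hik] at hij
      exact absurd hij.symm (hxa _ (by omega) _ (by omega))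
    · rw [hex i hik] at hij
      have := hinj (Set.mem_Iic.2 (by omega)) (Set.mem_Iic.2 (by omega)) hij
      omega
  · rcases lt_or_ge (i : ℕ) k with hik | hik <;> rcases lt_or_ge (j : ℕ) k with hjk | hjk
    · rw [hea i hi0.ne' hik, hea j hj0.ne' hjk] at hij
      have := hainj (Set.mem_Iio.2 (by omega)) (Set.mem_Iio.2 (by omega)) hij
      omega
    · rw [hea i hi0.ne' hik, hex j hjk] at hij
      exact absurd hij.symm (hxa _ (by omega) _ (by omega))
    · rw [hex i hik, hea j hj0.ne' hjk] at hij
      exact absurd hij (hxa _ (by omega) _ (by omega))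
    · rw [hex i hik, hex j hjk] at hij
      have := hinj (Set.mem_Iic.2 (by omega)) (Set.mem_Iic.2 (by omega)) hij
      omega

/-! ### Comets in graphs -/

variable {V : Type*} [Fintype V]

theorem eq_of_degree_eq_one {G : SimpleGraph V} {a u v : V} (ha : G.degree a = 1)
    (hu : G.Adj a u) (hv : G.Adj a v) : u = v := by
  rw [← card_neighborFinset_eq_degree] at ha
  exact Finset.card_le_one.1 ha.le u ((mem_neighborFinset _ _ _).2 hu) v
    ((mem_neighborFinset _ _ _).2 hv)

/-- An inner vertex of a path has two neighbours on the path. -/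
theorem Walk.IsPath.pair_neighbors {T : SimpleGraph V} {a b : V} {p : T.Walk a b} (hp : p.IsPath)
    {i : ℕ} (h0 : 0 < i) (hi : i < p.length) :
    ({p.getVert (i - 1), p.getVert (i + 1)} : Finset V).card = 2 ∧
      ({p.getVert (i - 1), p.getVert (i + 1)} : Finset V) ⊆ T.neighborFinset (p.getVert i) := by
  constructor
  · refine Finset.card_pair fun hc => ?_
    have := hp.getVert_injOn (by simp; omega) (by simp; omega) hc
    omega
  · intro u hu
    rw [mem_neighborFinset]
    rw [Finset.mem_insert, Finset.mem_singleton] at hu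
    rcases hu with rfl | rfl
    · have := p.adj_getVert_succ (i := i - 1) (by omega)
      rw [Nat.sub_add_cancel h0] at this
      exact this.symm
    · exact p.adj_getVert_succ hi

theorem Walk.IsPath.eq_zero_or_eq_length {T : SimpleGraph V} {a b : V} {p : T.Walk a b}
    (hp : p.IsPath) {i : ℕ} (hi : i ≤ p.length) (hdeg : T.degree (p.getVert i) = 1) :
    i = 0 ∨ i = p.length := by
  by_contra hc
  have h1 := hp.pair_neighbors (i := i) (by omega) (by omega)
  have h2 := Finset.card_le_card h1.2
  rw [card_neighborFinset_eq_degree] at h2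
  omega

/-- A path that starts at a leaf next to the centre of a comet begins with this leaf and the centre,
and goes on along the tail. -/
theorem cometGraph_isContained_of_path {T : SimpleGraph V} {k : ℕ} (hk : 2 ≤ k) {v : V}
    (hv : T.degree v = k)
    (hleaf : k - 1 ≤ ((T.neighborFinset v).filter fun w => T.degree w = 1).card)
    {a b : V} {p : T.Walk a b} (hp : p.IsPath) (hlen : p.length + k = Fintype.card V + 1)
    (ha : T.degree a = 1) (hva : T.Adj v a) : cometGraph (Fintype.card V) k ⊑ T := by
  have hkn : k < Fintype.card V := hv ▸ T.degree_lt_card_verts v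
  have h1 : p.getVert 1 = v := by
    have := p.adj_getVert_succ (i := 0) (by omega)
    rw [Walk.getVert_zero] at this
    exact eq_of_degree_eq_one ha this hva.symm
  have hinj : Set.InjOn (fun i => p.getVert (i + 1)) (Set.Iic (Fintype.card V - k)) := by
    intro i hi j hj hij
    rw [Set.mem_Iic] at hi hj
    have := hp.getVert_injOn (by simp; omega) (by simp; omega) hij
    omega
  have hadj : ∀ i < Fintype.card V - k, T.Adj (p.getVert (i + 1)) (p.getVert (i + 1 + 1)) :=
    fun i hi => p.adj_getVert_succ (by omega)
  by_cases hstar : Fintype.card V - k = 1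
  · have h2 : p.getVert 2 ∈ T.neighborFinset v := by
      rw [mem_neighborFinset, ← h1]
      exact hadj 0 (by omega)
    refine cometGraph_isContained (by omega) hkn (fun i => p.getVert (i + 1)) hinj hadj
      ((T.neighborFinset v).erase (p.getVert 2)) ?_ ?_ ?_
    · rw [Finset.card_erase_of_mem h2, card_neighborFinset_eq_degree, hv]
    · intro a ha
      rw [Finset.mem_erase, mem_neighborFinset] at ha
      exact h1 ▸ ha.2
    · intro i hi
      rw [Finset.mem_erase, mem_neighborFinset]
      rintro ⟨h3, h4⟩
      have : i = 0 ∨ i = 1 := by omega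
      rcases this with rfl | rfl
      · exact T.loopless.irrefl v (h1 ▸ h4)
      · exact h3 rfl
  · obtain ⟨A, hAsub, hA⟩ := Finset.exists_subset_card_eq hleaf
    refine cometGraph_isContained (by omega) hkn (fun i => p.getVert (i + 1)) hinj hadj A hA ?_ ?_
    · intro a ha
      have := (Finset.mem_filter.1 (hAsub ha)).1
      rw [mem_neighborFinset] at this
      exact h1 ▸ this
    · intro i hi hc
      obtain ⟨h2, h3⟩ := Finset.mem_filter.1 (hAsub hc)
      rw [mem_neighborFinset] at h2
      -- A leaf on the path after the centre is the other end of the path, so that the centre is the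
      -- last vertex but one.
      have h4 := (hp.eq_zero_or_eq_length (by omega) h3).resolve_left (by omega)
      have h5 := p.adj_getVert_succ (i := i) (by omega)
      have h6 := eq_of_degree_eq_one h3 h5.symm h2.symm
      have h7 := hp.getVert_injOn (by simp; omega) (by simp; omega) (h6.trans h1.symm)
      omega

/-- Counting the vertices off the path in the definition of a comet shows that a leaf next to the
centre is on the path, and this leaf can only be an end of it. -/
theorem IsComet.cometGraph_isContained {T : SimpleGraph V} {k : ℕ} (hT : T.IsComet k) :
    cometGraph (Fintype.card V) k ⊑ T := by
  obtain ⟨hn, hk, hT, hmax, v, hv, ⟨a, b, p, hp, hlen, hvp⟩, hleaf⟩ := hT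
  -- The vertices off the path are too few to contain all leaves next to the centre.
  obtain ⟨u, huL, hup⟩ : ∃ u ∈ (T.neighborFinset v).filter fun w => T.degree w = 1,
      u ∈ p.support := by
    by_contra hc
    push Not at hc
    have hdisj : Disjoint ((T.neighborFinset v).filter fun w => T.degree w = 1)
        p.support.toFinset := by
      rw [Finset.disjoint_left]
      intro u hu hu'
      exact hc u hu (List.mem_toFinset.1 hu')
    have h1 := Finset.card_le_univ
      (((T.neighborFinset v).filter fun w => T.degree w = 1) ∪ p.support.toFinset)
    rw [Finset.card_union_of_disjoint hdisj, List.toFinset_card_of_nodup hp.support_nodup,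
      Walk.length_support] at h1
    omega
  obtain ⟨huv, hu1⟩ := Finset.mem_filter.1 huL
  rw [mem_neighborFinset] at huv
  obtain ⟨i, rfl, hi⟩ := Walk.mem_support_iff_exists_getVert.1 hup
  rcases hp.eq_zero_or_eq_length hi hu1 with rfl | rfl
  · rw [Walk.getVert_zero] at hu1 huv
    exact cometGraph_isContained_of_path hk hv hleaf hp hlen hu1 huv
  · rw [Walk.getVert_length] at hu1 huv
    exact cometGraph_isContained_of_path hk hv hleaf hp.reverse (by simpa using hlen) hu1 huv

/-- All comets with the same parameters are isomorphic. -/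
theorem IsComet.nonempty_iso {T : SimpleGraph V} {k : ℕ} (hT : T.IsComet k) :
    Nonempty (cometGraph (Fintype.card V) k ≃g T) := by
  obtain ⟨f⟩ := hT.cometGraph_isContained
  have : NeZero (Fintype.card V) := ⟨by have := hT.1; omega⟩
  let e : Fin (Fintype.card V) ≃ V := Equiv.ofBijective f
    ((Fintype.bijective_iff_injective_and_card f).2 ⟨f.injective, by simp⟩)
  -- The image of the comet is connected, hence it is the whole tree.
  have hle : (cometGraph (Fintype.card V) k).map e.toEmbedding ≤ T :=
    map_le_iff_le_comap _ _ _ |>.2 fun a b hab => f.toHom.map_adj hab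
  have heq := hT.2.2.1.eq_of_connected_le hle
    ((Iso.map e (cometGraph (Fintype.card V) k)).connected_iff.1 (cometGraph_isTree _ k).connected)
  exact ⟨heq ▸ Iso.map e (cometGraph (Fintype.card V) k)⟩

theorem status_le_of_iso {W : Type*} [Fintype W] {G : SimpleGraph V} {H : SimpleGraph W}
    (e : G ≃g H) (hH : H.Connected) : G.status ≤ H.status := by
  have := hH.nonempty
  obtain ⟨x, hx⟩ := H.exists_vertexStatus_eq_status
  rw [← hx]
  refine (G.status_le_vertexStatus (e.symm x)).trans ?_
  unfold vertexStatus
  rw [← Equiv.sum_comp e.symm.toEquiv]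
  refine Finset.sum_le_sum fun y _ => ?_
  obtain ⟨w, hw⟩ := hH.exists_walk_length_eq_dist x y
  rw [← hw, ← Walk.length_map e.symm.toHom w]
  exact dist_le _

/-- A longest path of a connected graph of maximum degree at most two visits every vertex: it cannot
be left at an end because it is longest, nor elsewhere because of the degrees. -/
theorem Connected.exists_isPath_length {G : SimpleGraph V} (hG : G.Connected)
    (hk : G.maxDegree ≤ 2) :
    ∃ (a b : V) (p : G.Walk a b), p.IsPath ∧ p.length + 1 = Fintype.card V := by
  obtain ⟨r⟩ := hG.nonempty
  let S : Set ℕ := {m | ∃ (a b : V) (p : G.Walk a b), p.IsPath ∧ p.length = m}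
  have hS : BddAbove S := by
    refine ⟨Fintype.card V, ?_⟩
    rintro _ ⟨a, b, p, hp, rfl⟩
    exact hp.length_lt.le
  obtain ⟨a, b, p, hp, hlen⟩ : sSup S ∈ S := Nat.sSup_mem ⟨0, r, r, .nil, .nil, rfl⟩ hS
  have hmax : ∀ (c d : V) (q : G.Walk c d), q.IsPath → q.length ≤ p.length :=
    fun c d q hq => hlen ▸ le_csSup hS ⟨c, d, q, hq, rfl⟩
  have hall : ∀ v, v ∈ p.support := by
    intro v
    by_contra hv
    obtain ⟨w⟩ := hG a v
    obtain ⟨⟨⟨x, y⟩, hxy⟩, -, hx, hy⟩ := w.exists_boundary_dart {u | u ∈ p.support}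
      p.start_mem_support hv
    simp only [Set.mem_ofPred_eq] at hx hy
    obtain ⟨i, rfl, hi⟩ := Walk.mem_support_iff_exists_getVert.1 hx
    rcases Nat.eq_zero_or_pos i with rfl | hi0
    · rw [Walk.getVert_zero] at hxy
      have := hmax _ _ _ (hp.cons hy (h := hxy.symm))
      simp at this
    rcases hi.lt_or_eq with hi | rfl
    · have h1 := hp.pair_neighbors hi0 hi
      have hy' : y ∉ ({p.getVert (i - 1), p.getVert (i + 1)} : Finset V) := by
        rw [Finset.mem_insert, Finset.mem_singleton]
        rintro (rfl | rfl) <;> exact hy (p.getVert_mem_support _)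
      have h2 := Finset.card_le_card (Finset.insert_subset
        ((G.mem_neighborFinset _ _).2 hxy) h1.2)
      rw [Finset.card_insert_of_notMem hy', h1.1, card_neighborFinset_eq_degree] at h2
      have := h2.trans (G.degree_le_maxDegree _)
      omega
    · rw [Walk.getVert_length] at hxy
      have := hmax _ _ _ (hp.concat hy hxy)
      simp at this
  refine ⟨a, b, p, hp, ?_⟩
  rw [← Walk.length_support, ← List.toFinset_card_of_nodup hp.support_nodup, ← Finset.card_univ]
  congr 1
  ext v
  simp [hall v]

/-- The tail of the comet starts at the second vertex of the path; the first one is its only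
other leaf. -/
theorem cometGraph_two_isContained {G : SimpleGraph V} (hG : G.Connected) (hk : G.maxDegree ≤ 2)
    (hn : 3 ≤ Fintype.card V) : cometGraph (Fintype.card V) 2 ⊑ G := by
  obtain ⟨a, b, p, hp, hlen⟩ := hG.exists_isPath_length hk
  refine cometGraph_isContained (by omega) (by omega) (fun i => p.getVert (i + 1)) ?_
    (fun i hi => p.adj_getVert_succ (by omega)) {p.getVert 0} (by simp) ?_ ?_
  · intro i hi j hj hij
    rw [Set.mem_Iic] at hi hj
    have := hp.getVert_injOn (by simp; omega) (by simp; omega) hij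
    omega
  · intro c hc
    rw [Finset.mem_singleton.1 hc]
    exact (p.adj_getVert_succ (by omega)).symm
  · intro i hi hc
    have := hp.getVert_injOn (by simp; omega) (by simp) (Finset.mem_singleton.1 hc)
    omega

theorem IsParent.card_children_root {G : SimpleGraph V} {p : V → V} {r : V}
    (h : IsParent p r (G.dist r)) (hadj : ∀ v, v ≠ r → G.Adj v (p v)) :
    (children p r r).card = G.degree r := by
  refine le_antisymm ((Nat.le_add_right _ _).trans (h.card_children_add_le_degree hadj r)) ?_
  rw [← card_neighborFinset_eq_degree]
  refine Finset.card_le_card fun v hv => ?_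
  rw [mem_neighborFinset] at hv
  refine mem_children.2 ⟨hv.ne', h.level_eq_zero.1 ?_⟩
  have h1 := h.level v hv.ne'
  rw [dist_eq_one_iff_adj.2 hv] at h1
  omega

/-- A vertex of degree `k` and a vertex at distance `n - k` from it give rise to a comet. -/
theorem cometGraph_isContained_of_dist {G : SimpleGraph V} {k : ℕ} (hk : 1 ≤ k) {r v : V}
    {p : V → V} (h : IsParent p r (G.dist r)) (hadj : ∀ v, v ≠ r → G.Adj v (p v))
    (hr : G.degree r = k) (hv : Fintype.card V ≤ G.dist r v + k) :
    cometGraph (Fintype.card V) k ⊑ G := by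
  have hkn : k < Fintype.card V := hr ▸ G.degree_lt_card_verts r
  obtain ⟨u, -, hu⟩ := h.exists_anc_level v (i := Fintype.card V - k) (by omega)
  have hlev : ∀ i ≤ Fintype.card V - k, G.dist r (p^[Fintype.card V - k - i] u) = i := by
    intro i hi
    rw [h.level_iterate]
    omega
  have h0 : p^[Fintype.card V - k - 0] u = r := h.level_eq_zero.1 (hlev 0 (by omega))
  have hx : ∀ i < Fintype.card V - k,
      G.Adj (p^[Fintype.card V - k - i] u) (p^[Fintype.card V - k - (i + 1)] u) := by
    intro i hi
    rw [show Fintype.card V - k - i = (Fintype.card V - k - (i + 1)) + 1 by omega,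
      Function.iterate_succ_apply']
    exact (hadj _ (h.ne_root (hlev (i + 1) (by omega)))).symm
  have h1 : p^[Fintype.card V - k - 1] u ∈ G.neighborFinset r := by
    rw [mem_neighborFinset, ← dist_eq_one_iff_adj]
    exact hlev 1 (by omega)
  refine cometGraph_isContained hk hkn (fun i => p^[Fintype.card V - k - i] u) ?_ hx
    ((G.neighborFinset r).erase (p^[Fintype.card V - k - 1] u)) ?_ ?_ ?_
  · intro i hi j hj hij
    rw [← hlev i hi, ← hlev j hj]
    exact congrArg _ hij
  · rw [Finset.card_erase_of_mem h1, card_neighborFinset_eq_degree, hr]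
  · intro a ha
    rw [Finset.mem_erase, mem_neighborFinset] at ha
    rw [h0]
    exact ha.2
  · intro i hi hc
    rw [Finset.mem_erase, mem_neighborFinset, ← dist_eq_one_iff_adj, hlev i hi] at hc
    exact hc.1 (by rw [hc.2])

/-- Among the trees with given order and maximum degree, rooted at a vertex of maximum degree, the
comet has the most deep edges, for every `j` at once. -/
theorem deepEdges_le_comet {p : V → V} {r : V} {l : V → ℕ} (h : IsParent p r l)
    {k : ℕ} (hk : 0 < k) (hr : (children p r r).card = k) [NeZero (Fintype.card V)]
    {j : ℕ} (hj : 0 < j) :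
    deepEdges p r j ≤ deepEdges (finParent (Fintype.card V) (cometParent_le k)) 0 j := by
  rcases (Nat.succ_le_of_lt hj).lt_or_eq with hj1 | rfl
  · have h1 := h.deepEdges_le_sub_children hj1 (by omega)
    have h2 := h.deepEdges_le_sub_two_mul hj1
    have h3 := le_deepEdges_comet (n := Fintype.card V) hk hj
    omega
  · rw [h.deepEdges_one, (isParent_comet _ k).deepEdges_one, Fintype.card_fin]

theorem status_le_comet {G : SimpleGraph V} (hG : G.Connected) {k : ℕ} (hk : G.maxDegree = k)
    (hk2 : 2 ≤ k) (hn : 3 ≤ Fintype.card V) :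
    G.status ≤ (cometGraph (Fintype.card V) k).status ∧
      (G.status = (cometGraph (Fintype.card V) k).status →
        cometGraph (Fintype.card V) k ⊑ G) := by
  have := hG.nonempty
  have : NeZero (Fintype.card V) := ⟨by omega⟩
  obtain ⟨r, hr⟩ := G.exists_maximal_degree_vertex
  rw [hk, eq_comm] at hr
  have hkn : k < Fintype.card V := hr ▸ G.degree_lt_card_verts r
  obtain ⟨p, h, hadj⟩ := hG.exists_isParent r
  have hch : (children p r r).card = k := (h.card_children_root hadj).trans hr
  have h1 := h.status_le_sum_deepEdges hG hadj
  have h2 : ∀ j ∈ Finset.Icc 1 (Fintype.card V), deepEdges p r j ≤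
      deepEdges (finParent (Fintype.card V) (cometParent_le k)) 0 j :=
    fun j hj => deepEdges_le_comet h (by omega) hch (Finset.mem_Icc.1 hj).1
  have h3 := (isParent_comet (Fintype.card V) k).sum_deepEdges_le_status
  rw [Fintype.card_fin] at h3
  have h4 := Finset.sum_le_sum h2
  refine ⟨h1.trans (h4.trans h3), fun heq => ?_⟩
  rcases hk2.lt_or_eq with hk3 | rfl
  · -- The counts of deep edges in `G` and in the comet agree for every `j`.
    change _ = (parentGraph _).status at heq
    have h5 := (Finset.sum_eq_sum_iff_of_le h2).1 (by omega)
    have h6 : ∀ j ∈ Finset.Icc 1 (Fintype.card V),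
        Fintype.card V + 1 - j - max j k ≤ deepEdges p r j := fun j hj =>
      h5 j hj ▸ le_deepEdges_comet (by omega) (Finset.mem_Icc.1 hj).1
    have h7 := h6 2 (Finset.mem_Icc.2 (by omega))
    have h8 := h6 3 (Finset.mem_Icc.2 (by omega))
    obtain ⟨v, hv⟩ := h.exists_level_ge hk3 hkn hch (by omega) (by omega)
    exact cometGraph_isContained_of_dist (by omega) h hadj hr hv
  · -- The comet is a path here, and `G` is spanned by a path.
    exact cometGraph_two_isContained hG hk.le hn

end

end SimpleGraph

theorem mainTheorem2 {V : Type*} [Fintype V] (G : SimpleGraph V) [DecidableRel G.Adj]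
    (n k : ℕ) (hG : G.Connected) (hn : Fintype.card V = n) (hk : G.maxDegree = k) :
    -- `B_{n,k}` exists; for every choice of it, the lower bound holds, with the equality case (i)
    ((∃ B : SimpleGraph (Fin n), B.IsBalancedTree k) ∧
      ∀ B : SimpleGraph (Fin n), B.IsBalancedTree k →
        B.status ≤ G.status ∧
        (G.status = B.status ↔ ∃ T : SimpleGraph V, T ≤ G ∧ T.IsBalancedTree k)) ∧
    -- for `n ≥ 3`, `S_{n,k}` exists, and the upper bound and (ii) hold
    (3 ≤ n →
      (∃ S : SimpleGraph (Fin n), S.IsComet k) ∧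
      ∀ S : SimpleGraph (Fin n), S.IsComet k →
        G.status ≤ S.status ∧
        (G.status = S.status → S.IsContained G)) := by
  classical
  have := hG.nonempty
  have hk' : @SimpleGraph.maxDegree V G _ (Classical.decRel G.Adj) = k := by
    convert hk
  have hkn : k < n := hk ▸ hn ▸ G.maxDegree_lt_card_verts
  have hsmall : k ≤ 1 → n ≤ k + 1 := fun h1 => by
    rw [← hk', ← hn]
    exact hG.card_le_of_maxDegree_le_one (hk'.le.trans h1)
  refine ⟨⟨SimpleGraph.exists_isBalancedTree hkn hsmall, fun B hB => ?_⟩, fun hn3 => ?_⟩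
  · have hBs := hB.status_eq
    rw [Fintype.card_fin] at hBs
    rw [hBs]
    have hle := SimpleGraph.balancedStatus_le_status hG hk'.le
    rw [hn] at hle
    refine ⟨hle, fun hs => SimpleGraph.exists_isBalancedTree_le hG hk' (hn ▸ hs), ?_⟩
    rintro ⟨T, hTG, hT⟩
    exact le_antisymm
      ((SimpleGraph.status_anti hTG hT.1.connected).trans (hn ▸ hT.status_eq.le)) hle
  · have hk2 : 2 ≤ k := by omega
    refine ⟨⟨_, SimpleGraph.cometGraph_isComet hn3 hk2 hkn⟩, fun S hS => ?_⟩
    subst hn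
    obtain ⟨e⟩ := hS.nonempty_iso
    rw [Fintype.card_fin] at e
    have hle := SimpleGraph.status_le_of_iso e hS.2.2.1.connected
    have hcomet := SimpleGraph.status_le_comet hG hk' hk2 hn3
    refine ⟨hcomet.1.trans hle, fun heq => ?_⟩
    exact e.isContained'.trans (hcomet.2 (by have := hcomet.1; omega))
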